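/- Let $K\ge 0$ and let $R=(r_{ab})_{1\le a,b\le K+1}$ be an upper triangular matrix with nonnegative entries and all row sums equal to $1$; write $r_k=r_{kk}$. Let $\boldsymbol C_0$ be a deterministic vector with strictly positive coordinates summing to $1$. Consider the urn $(\boldsymbol C_n)_{n\ge 0}$ in which, given the first $n$ draws, the $(n+1)$-st draw shows colour $a$ with probability $\boldsymbol C_{n,a}/(n+1)$, and then $\boldsymbol C_{n+1}$ is $\boldsymbol C_n$ plus the $a$-th row of $R$. Let $1=i_1<\dots<i_{J+1}=K+1$ be the indices of the running maxima of the diagonal, i.e. the indices $k$ with $r_m\le r_k$ for all $m<k$. The $j$-th block consists of the colours $i_j,\dots,i_{j+1}-1$ for $j\le J$, and block $J+1$ is $\{K+1\}$. Assume that the colours are in increasing order, $$\sum_{m=i_j}^{k-1} r_{mk}>0\quad\text{for } i_j<k<i_{j+1},\ 1\le j\le J,$$ and that for $1\le j\le J$ $$\sum_{m=i_j}^{i_{j+1}-1} r_{m,i_{j+1}}>0\quad\text{whenever } r_{i_j}=r_{i_{j+1}}.$$ Let $\boldsymbol C_n^{(j)}$ be the part of $\boldsymbol C_n$ in block $j$,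 $R^{(j)}$ the submatrix of $R$ with rows and columns in block $j$, $\lambda_j=r_{i_j}$, $\nu_j=\#\{m<i_j: r_m=\lambda_j\}$, and, for $j\le J$, $\boldsymbol\rho^{(j)}=(r_{m,i_{j+1}})_{i_j\le m<i_{j+1}}$. Then for each $j$ there is a unique row vector $\boldsymbol\pi^{(j)}$ with $\boldsymbol\pi^{(j)}R^{(j)}=\lambda_j\boldsymbol\pi^{(j)}$ and first coordinate $1$, and there are square-integrable random variables $V_1,\dots,V_{J+1}$ such that, for $j=1,\dots,J+1$, $$\frac{\boldsymbol C_N^{(j)}}{N^{\lambda_j}(\log N)^{\nu_j}}\longrightarrow \boldsymbol\pi^{(j)}V_j\qquad\text{almost surely and in }L^2 \text{ as } N\to\infty .$$ Moreover, almost surely, $V_{J+1}=1$, and if $r_1=0$ then $V_1=\boldsymbol C_{0,1}$. If $r_1>0$ and $J\ge1$, then $V_1$ is nondegenerate (not almost surely constant). For $2\le j\le J$ with $\nu_j=0$, $V_j$ is nondegenerate. For $2\le j\le J$ with $\nu_j>0$, $$V_j=\frac1{\nu_j}\,\boldsymbol\pi^{(j-1)}\boldsymbol\rho^{(j-1)}\,V_{j-1}\qquad\text{almost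 surely}.$$ -/

import Mathlib

open Filter Topology MeasureTheory

noncomputable section

namespace TriangularUrn

/-! The `K + 1` colours are indexed by `Fin (K + 1)`, the `J + 1` blocks by `Fin (J + 1)`. -/

variable {K J : ℕ} {Ω : Type*}

/-- `i` lists, in increasing order, the indices of the (weak) running maxima of the diagonal of
`R`: the indices `k` whose diagonal entry is at least every earlier diagonal entry. These are the
leading indices of the blocks. -/
structure IsRunningMaxima (R : Matrix (Fin (K + 1)) (Fin (K + 1)) ℝ)
    (i : Fin (J + 1) → Fin (K + 1)) : Prop where
  strictMono : StrictMono i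
  range_eq : Set.range i = {k | ∀ m, m < k → R m m ≤ R k k}

/-- The colours are in increasing order: every non-leading colour `k` of a block has a positive
sum of the entries of the `k`-th column from the leading row of the block up to row `k - 1`. -/
def InIncreasingOrder (R : Matrix (Fin (K + 1)) (Fin (K + 1)) ℝ)
    (i : Fin (J + 1) → Fin (K + 1)) : Prop :=
  ∀ (j : Fin J) (k : Fin (K + 1)), i j.castSucc < k → k < i j.succ →
    0 < ∑ m ∈ Finset.Ico (i j.castSucc) k, R m k

/-- The condition that makes the arrangement in increasing order unique. -/
def UniqueArrangement (R : Matrix (Fin (K + 1)) (Fin (K + 1)) ℝ)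
    (i : Fin (J + 1) → Fin (K + 1)) : Prop :=
  ∀ j : Fin J, R (i j.castSucc) (i j.castSucc) = R (i j.succ) (i j.succ) →
    0 < ∑ m ∈ Finset.Ico (i j.castSucc) (i j.succ), R m (i j.succ)

/-- The colours of the `j`-th block: from its leading index up to, and excluding, the leading
index of the next block (if there is one). -/
abbrev Block (i : Fin (J + 1) → Fin (K + 1)) (j : Fin (J + 1)) : Type :=
  {k : Fin (K + 1) // i j ≤ k ∧ ∀ j', j < j' → k < i j'}

/-- The diagonal submatrix of `R` of the `j`-th block. -/
def blockMatrix (R : Matrix (Fin (K + 1)) (Fin (K + 1)) ℝ) (i : Fin (J + 1) → Fin (K + 1))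
    (j : Fin (J + 1)) : Matrix (Block i j) (Block i j) ℝ :=
  R.submatrix Subtype.val Subtype.val

/-- `λ_j`, the diagonal entry of the leading colour of the `j`-th block. -/
def leadEntry (R : Matrix (Fin (K + 1)) (Fin (K + 1)) ℝ) (i : Fin (J + 1) → Fin (K + 1))
    (j : Fin (J + 1)) : ℝ :=
  R (i j) (i j)

/-- `ν_j`, the number of earlier colours with the same diagonal entry `λ_j`. -/
def multIndex (R : Matrix (Fin (K + 1)) (Fin (K + 1)) ℝ) (i : Fin (J + 1) → Fin (K + 1))
    (j : Fin (J + 1)) : ℕ :=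
  Nat.card {m : Fin (K + 1) // m < i j ∧ R m m = leadEntry R i j}

/-- `ρ^{(j)}`, the part in the rows of the `j`-th block of the column of the leading colour of
the next block; defined for every block but the last. -/
def nextLeadColumn (R : Matrix (Fin (K + 1)) (Fin (K + 1)) ℝ) (i : Fin (J + 1) → Fin (K + 1))
    (j : Fin J) : Block i j.castSucc → ℝ :=
  fun m => R m.1 (i j.succ)

/-- `p` is a left eigenvector of the `j`-th block matrix for the eigenvalue `λ_j` whose first
coordinate (the one of the leading colour) is `1`. -/
def IsNormalizedLeftEigenvector (R : Matrix (Fin (K + 1)) (Fin (K + 1)) ℝ)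
    (i : Fin (J + 1) → Fin (K + 1)) (j : Fin (J + 1)) (p : Block i j → ℝ) : Prop :=
  Matrix.vecMul p (blockMatrix R i j) = leadEntry R i j • p ∧ ∀ k : Block i j, k.1 = i j → p k = 1

/-- The composition `C_n` of the urn after `n` draws, where `draw n ω` is the colour that appears
at draw number `n + 1`: the drawn ball is returned, and the row of `R` of its colour is added. -/
def urnCount (R : Matrix (Fin (K + 1)) (Fin (K + 1)) ℝ) (c₀ : Fin (K + 1) → ℝ)
    (draw : ℕ → Ω → Fin (K + 1)) : ℕ → Ω → Fin (K + 1) → ℝ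
  | 0, _, k => c₀ k
  | n + 1, ω, k => urnCount R c₀ draw n ω k + R (draw n ω) k

/-- The σ-algebra generated by the first `n` draws. -/
abbrev drawHistory (draw : ℕ → Ω → Fin (K + 1)) (n : ℕ) : MeasurableSpace Ω :=
  ⨆ s ∈ Finset.range n, MeasurableSpace.comap (draw s) ⊤

/-- `draw` is the sequence of colours drawn from the urn with initial composition `c₀` and
replacement matrix `R`: given the first `n` draws, colour `k` appears at draw number `n + 1` with
conditional probability `C_{n, k} / (n + 1)`. -/
structure IsUrnProcess [MeasurableSpace Ω] (μ : Measure Ω)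
    (R : Matrix (Fin (K + 1)) (Fin (K + 1)) ℝ) (c₀ : Fin (K + 1) → ℝ)
    (draw : ℕ → Ω → Fin (K + 1)) : Prop where
  measurable : ∀ n, Measurable (draw n)
  condProb : ∀ (n : ℕ) (k : Fin (K + 1)),
    μ[(draw n ⁻¹' {k}).indicator (fun _ => (1 : ℝ)) | drawHistory draw n]
      =ᵐ[μ] fun ω => urnCount R c₀ draw n ω k / ((n : ℝ) + 1)

/-- The scaled block counts `C^{(j)}_N / (N ^ λ_j (log N) ^ ν_j)`, a vector indexed by the block. -/
def scaledBlock (R : Matrix (Fin (K + 1)) (Fin (K + 1)) ℝ) (i : Fin (J + 1) → Fin (K + 1))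
    (c₀ : Fin (K + 1) → ℝ) (draw : ℕ → Ω → Fin (K + 1)) (j : Fin (J + 1)) (N : ℕ) (ω : Ω) :
    Block i j → ℝ :=
  fun k => urnCount R c₀ draw N ω k.1 /
    ((N : ℝ) ^ leadEntry R i j * Real.log N ^ multIndex R i j)

/-- A random variable is non-degenerate if it is not almost surely constant. -/
def Nondegenerate [MeasurableSpace Ω] (μ : Measure Ω) (X : Ω → ℝ) : Prop :=
  ¬ ∃ c : ℝ, ∀ᵐ ω ∂μ, X ω = c

end TriangularUrn

end

/-! Splitting each increment into its conditional mean and a martingale difference `ξ` turns the urn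
into a linear recursion. In coordinate `k`, `x (n+1) k = (1 + r_k/(n+1)) x n k + (n+1)⁻¹ ∑_{m<k} R m
k x n m + ξ n k`, because `R` is triangular. The homogeneous solution is `riseProd r_k n`, of order
`n ^ r_k`, and the forcing comes from earlier colours, so the asymptotics follow by induction on
`k`.

Three regimes occur. A non-leading colour has `r_k < λ_j`, so the forcing from its own block
dominates: Stolz–Cesàro gives the limit `(λ_j - r_k)⁻¹ ∑ R m k ℓ m`, which is the coordinatewise
equation of the left eigenvector. A leading colour with `λ_{j+1} > λ_j` receives forcing that is
summable after normalisation, so a new limit variable appears. A leading colour with `λ_{j+1} = λ_j`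
is resonant: the forcing has the order of the homogeneous solution up to logarithms, which produces
one more logarithm and determines the new limit from the previous one, with the factor `1/ν`.

This analysis is deterministic and needs only that the normalised noise series converges, so
`IsRunningMaxima.exists_limits` is stated in a complete normed space and used three times. With
values in `ℝ` and no noise it bounds the mean composition. Since the increments of a colour lie in
`[0, 1]`, the noise variance is at most the mean increment, and the noise series, normalised by the
block orders, has summable variances (`summable_integral_noise_sq`). Orthogonality and martingale
convergence then give convergence in `L²` and almost surely (`exists_tendsto_sum_martingale_diff`),
and `IsRunningMaxima.exists_limits` applies again in `L²` and on almost every path. The two limits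
agree along a subsequence.

For nondegeneracy, the mean composition given a first draw of the leading colour `k` is compared
with that given a first draw of the last colour. The difference vanishes before `k`, so at `k` it
solves the homogeneous recursion, and it survives the scaling when `r_k > 0` and `ν = 0`. Finally
`V_{J+1} = 1` because the urn total is deterministic and every other block is of smaller order. -/

namespace TriangularUrn

/-! ### Normalising sequences and their asymptotics -/

/-- The product `∏_{l < n} (1 + r / (l + 1))`, asymptotic to `n ^ r / Γ(1 + r)`. -/
noncomputable def riseProd (r : ℝ) (n : ℕ) : ℝ := ∏ l ∈ Finset.range n, (1 + r / ((l : ℝ) + 1))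

/-- A shifted harmonic sum, asymptotic to `log n` and at least `1` everywhere. -/
noncomputable def harm (n : ℕ) : ℝ := 1 + ∑ l ∈ Finset.range n, 1 / ((l : ℝ) + 1)

/-- The normalising sequence `riseProd r n * harm n ^ s`. -/
noncomputable def scale (r : ℝ) (s : ℕ) (n : ℕ) : ℝ := riseProd r n * harm n ^ s

lemma riseProd_succ (r : ℝ) (n : ℕ) :
    riseProd r (n + 1) = riseProd r n * (1 + r / ((n : ℝ) + 1)) := Finset.prod_range_succ _ _

lemma riseProd_zero (r : ℝ) : riseProd r 0 = 1 := by simp [riseProd]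

lemma riseProd_pos {r : ℝ} (hr : 0 ≤ r) (n : ℕ) : 0 < riseProd r n :=
  Finset.prod_pos fun l _ => by positivity

lemma harm_succ (n : ℕ) : harm (n + 1) = harm n + 1 / ((n : ℝ) + 1) := by
  simp [harm, Finset.sum_range_succ, add_assoc]

lemma harm_mono : Monotone harm := monotone_nat_of_le_succ fun n => by
  rw [harm_succ]
  linarith [show 0 < 1 / ((n : ℝ) + 1) by positivity]

lemma one_le_harm (n : ℕ) : 1 ≤ harm n := by
  have : 0 ≤ ∑ l ∈ Finset.range n, 1 / ((l : ℝ) + 1) := Finset.sum_nonneg fun l _ => by positivity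
  simp only [harm]; linarith

lemma harm_pos (n : ℕ) : 0 < harm n := zero_lt_one.trans_le (one_le_harm n)

lemma scale_pos {r : ℝ} (hr : 0 ≤ r) (s n : ℕ) : 0 < scale r s n :=
  mul_pos (riseProd_pos hr n) (pow_pos (harm_pos n) s)

lemma tendsto_harm_atTop : Tendsto harm atTop atTop :=
  tendsto_atTop_add_const_left _ _ Real.tendsto_sum_range_one_div_nat_succ_atTop

lemma tendsto_harm_div_log : Tendsto (fun n : ℕ => harm n / Real.log n) atTop (𝓝 1) := by
  have h1 := Real.tendsto_harmonic_sub_log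
  have hl : Tendsto (fun n : ℕ => Real.log n) atTop atTop :=
    Real.tendsto_log_atTop.comp tendsto_natCast_atTop_atTop
  have h2 := ((h1.const_add 1).div_atTop hl).add_const 1
  rw [zero_add] at h2
  refine h2.congr' ?_
  filter_upwards [hl.eventually_gt_atTop 0] with n hn
  have : harm n = 1 + (harmonic n : ℝ) := by simp [harm, harmonic]
  rw [this]; field_simp; ring

/-- Gauss's product formula for `Γ (1 + r)`: the denominator of `Real.GammaSeq` is `n! * riseProd r
n * (n + r + 1)`, and the last factor is asymptotic to `n`. -/
lemma tendsto_riseProd_div_rpow {r : ℝ} (hr : 0 ≤ r) :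
    Tendsto (fun n : ℕ => riseProd r n / (n : ℝ) ^ r) atTop (𝓝 (Real.Gamma (1 + r))⁻¹) := by
  have hG : Real.Gamma (1 + r) ≠ 0 := (Real.Gamma_pos_of_pos (by linarith)).ne'
  have h1 := (Real.GammaSeq_tendsto_Gamma (1 + r)).inv₀ hG
  have h2 : Tendsto (fun n : ℕ => (n : ℝ) / (n + (r + 1))) atTop (𝓝 1) :=
    tendsto_natCast_div_add_atTop (r + 1)
  have h3 := h1.mul h2
  rw [mul_one] at h3
  refine h3.congr' ?_
  filter_upwards [eventually_gt_atTop 0] with n hn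
  have hn' : (0 : ℝ) < n := by exact_mod_cast hn
  have h4 : ∀ n : ℕ, ∏ j ∈ Finset.range (n + 1), (1 + r + (j : ℝ)) =
      n.factorial * riseProd r n * (n + (r + 1)) := by
    intro n
    induction n with
    | zero => simp [riseProd]; ring
    | succ n ih =>
      rw [Finset.prod_range_succ, ih, riseProd_succ, Nat.factorial_succ]
      push_cast
      field_simp
      ring
  have h5 := (riseProd_pos hr n).ne'
  have h6 : (n.factorial : ℝ) ≠ 0 := by exact_mod_cast n.factorial_ne_zero
  have h7 : (n : ℝ) ^ r ≠ 0 := (Real.rpow_pos_of_pos hn' r).ne'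
  have h8 : (n : ℝ) + (r + 1) ≠ 0 := by positivity
  rw [Real.GammaSeq, h4, Real.rpow_add hn', Real.rpow_one]
  field_simp

lemma tendsto_scale_div {r : ℝ} (hr : 0 ≤ r) (s : ℕ) :
    Tendsto (fun n : ℕ => scale r s n / ((n : ℝ) ^ r * Real.log n ^ s)) atTop
      (𝓝 (Real.Gamma (1 + r))⁻¹) := by
  have h := (tendsto_riseProd_div_rpow hr).mul (tendsto_harm_div_log.pow s)
  simp only [one_pow, mul_one] at h
  refine h.congr fun n => ?_
  rw [scale, div_pow, div_mul_div_comm]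

lemma tendsto_scale_div_scale {r r' : ℝ} (hr : 0 ≤ r) (hr' : 0 ≤ r') {s s' : ℕ}
    (h : r < r' ∨ r = r' ∧ s < s') :
    Tendsto (fun n => scale r s n / scale r' s' n) atTop (𝓝 0) := by
  rcases h with h | ⟨rfl, h⟩
  · have hG : Real.Gamma (1 + r') ≠ 0 := (Real.Gamma_pos_of_pos (by linarith)).ne'
    have h1 := (tendsto_scale_div hr s).div (tendsto_scale_div hr' 0) (inv_ne_zero hG)
    -- Powers of the logarithm lose to any positive power of `n`. The factor `harm n ^ s'` in the
    -- denominator is at least `1` and can be dropped.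
    have h2 : Tendsto (fun n : ℕ => Real.log n ^ s / (n : ℝ) ^ (r' - r)) atTop (𝓝 0) := by
      have := (isLittleO_log_rpow_rpow_atTop (s : ℝ) (sub_pos.2 h)).tendsto_div_nhds_zero
      simpa [Function.comp_def] using this.comp tendsto_natCast_atTop_atTop
    have h3 := h1.mul h2
    rw [mul_zero] at h3
    refine squeeze_zero' (Eventually.of_forall fun n =>
      (div_pos (scale_pos hr s n) (scale_pos hr' s' n)).le) ?_ h3
    filter_upwards [eventually_gt_atTop 1] with n hn
    have hn1 : (1 : ℝ) < n := by exact_mod_cast hn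
    have hn0 : (0 : ℝ) < n := by linarith
    have hl := Real.log_pos hn1
    have e : scale r s n / ((n : ℝ) ^ r * Real.log n ^ s) /
        (scale r' 0 n / ((n : ℝ) ^ r' * Real.log n ^ 0)) *
        (Real.log n ^ s / (n : ℝ) ^ (r' - r)) = scale r s n / scale r' 0 n := by
      have h5 := (scale_pos hr' 0 n).ne'
      have h6 := (Real.rpow_pos_of_pos hn0 r).ne'
      have h7 := (Real.rpow_pos_of_pos hn0 r').ne'
      rw [Real.rpow_sub hn0]
      field_simp
    simp only [Pi.div_apply]
    rw [e]
    have h8 : scale r' 0 n ≤ scale r' s' n := by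
      simp only [scale, pow_zero]
      exact mul_le_mul_of_nonneg_left (one_le_pow₀ (one_le_harm n)) (riseProd_pos hr' n).le
    exact div_le_div_of_nonneg_left (scale_pos hr s n).le (scale_pos hr' 0 n) h8
  · refine squeeze_zero (fun n => (div_pos (scale_pos hr s n) (scale_pos hr s' n)).le) (fun n => ?_)
      tendsto_harm_atTop.inv_tendsto_atTop
    have h1 := harm_pos n
    have h2 := riseProd_pos hr n
    obtain ⟨t, rfl⟩ := Nat.exists_eq_add_of_lt h
    simp only [scale, Pi.inv_apply]
    rw [mul_div_mul_left _ _ h2.ne', ← one_div, div_le_div_iff₀ (by positivity) h1]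
    have : harm n ^ s * 1 ≤ harm n ^ s * harm n ^ t :=
      mul_le_mul_of_nonneg_left (one_le_pow₀ (one_le_harm n)) (by positivity)
    calc harm n ^ s * harm n ≤ (harm n ^ s * harm n ^ t) * harm n :=
          mul_le_mul_of_nonneg_right (by linarith) h1.le
      _ = 1 * harm n ^ (s + t + 1) := by ring

lemma summable_of_telescope {f g : ℕ → ℝ} (hf : ∀ n, 0 ≤ f n) (hg : ∀ n, 0 ≤ g n)
    (h : ∀ n, f n ≤ g n - g (n + 1)) : Summable f := by
  refine summable_of_sum_range_le (c := g 0) hf fun n => ?_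
  calc ∑ l ∈ Finset.range n, f l ≤ ∑ l ∈ Finset.range n, (g l - g (l + 1)) :=
        Finset.sum_le_sum fun l _ => h l
    _ = g 0 - g n := Finset.sum_range_sub' g n
    _ ≤ g 0 := sub_le_self _ (hg n)

/-- The quotient `riseProd r n / riseProd r' n` decreases, and its decrement is exactly `r' - r`
times the summand. -/
lemma summable_riseProd_div {r r' : ℝ} (hr : 0 ≤ r) (h : r < r') :
    Summable fun n : ℕ => riseProd r n / (((n : ℝ) + 1) * riseProd r' (n + 1)) := by
  have hr' : 0 ≤ r' := hr.trans h.le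
  have h' : 0 < r' - r := sub_pos.2 h
  have p1 := riseProd_pos hr
  have p2 := riseProd_pos hr'
  refine summable_of_telescope (g := fun n => riseProd r n / riseProd r' n / (r' - r))
    (fun n => ?_) (fun n => ?_) (fun n => le_of_eq ?_)
  · have := p1 n; have := p2 (n + 1); positivity
  · have := p1 n; have := p2 n; positivity
  · have h1 := (p2 n).ne'
    have h2 : (n : ℝ) + 1 + r' ≠ 0 := by positivity
    have h3 : (n : ℝ) + 1 ≠ 0 := by positivity
    simp only [riseProd_succ]
    have e : ∀ c : ℝ, 1 + c / ((n : ℝ) + 1) = ((n : ℝ) + 1 + c) / ((n : ℝ) + 1) := fun c => by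
      field_simp
    rw [e, e]
    field_simp
    ring

/-- Discrete form of the integrability of `1 / (t log² t)`: the antiderivative is `-1 / harm`. It
serves the blocks with `λ = 0`, where no power of `n` helps. -/
lemma summable_inv_harm_sq :
    Summable fun n : ℕ => 1 / (((n : ℝ) + 1) * harm (n + 1) ^ 2) := by
  refine summable_of_telescope (g := fun n => (harm n)⁻¹) (fun n => ?_) (fun n => ?_) fun n => ?_
  · have := harm_pos (n + 1); positivity
  · exact (inv_pos.2 (harm_pos n)).le
  · have h1 := harm_pos n
    have h2 := harm_pos (n + 1)
    have h3 : harm n ≤ harm (n + 1) := harm_mono n.le_succ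
    have e : (harm n)⁻¹ - (harm (n + 1))⁻¹ = 1 / (((n : ℝ) + 1) * (harm n * harm (n + 1))) := by
      have : harm (n + 1) - harm n = 1 / ((n : ℝ) + 1) := by rw [harm_succ]; ring
      rw [inv_sub_inv h1.ne' h2.ne', this]
      field_simp
    simp only [e]
    apply one_div_le_one_div_of_le (by positivity)
    rw [sq]
    gcongr

/-- With `t = 1 / ((n + 1) harm n)`, the expression is the difference quotient `((1 + t) ^ s - 1) /
t`, a geometric sum of `s` terms each tending to `1`. -/
lemma tendsto_harm_pow_ratio (s : ℕ) :
    Tendsto (fun n : ℕ => ((n : ℝ) + 1) * harm n * ((harm (n + 1) / harm n) ^ s - 1)) atTop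
      (𝓝 s) := by
  have ht : ∀ n, harm (n + 1) / harm n = 1 + 1 / ((n : ℝ) + 1) * (harm n)⁻¹ := fun n => by
    have := (harm_pos n).ne'
    rw [harm_succ]; field_simp
  have h1 : Tendsto (fun n => harm (n + 1) / harm n) atTop (𝓝 1) := by
    have := (tendsto_one_div_add_atTop_nhds_zero_nat (𝕜 := ℝ)).mul
      tendsto_harm_atTop.inv_tendsto_atTop
    have := this.const_add 1
    simp only [mul_zero, add_zero] at this
    exact this.congr fun n => (ht n).symm
  have h2 : Tendsto (fun n => ∑ i ∈ Finset.range s, (harm (n + 1) / harm n) ^ i) atTop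
      (𝓝 (∑ i ∈ Finset.range s, (1 : ℝ) ^ i)) := tendsto_finsetSum _ fun i _ => h1.pow i
  simp only [one_pow, Finset.sum_const, Finset.card_range, nsmul_eq_mul, mul_one] at h2
  refine h2.congr fun n => ?_
  rw [← geom_sum_mul (harm (n + 1) / harm n) s, ht n]
  have := (harm_pos n).ne'
  field_simp
  ring

/-! ### Scalar linear recursions with vector-valued forcing and noise -/

section Normed

variable {E : Type*} [NormedAddCommGroup E] [NormedSpace ℝ E]

/-- The Stolz–Cesàro theorem for vector-valued numerators. -/
lemma tendsto_inv_smul_of_increments {v z : ℕ → E} {d : ℕ → ℝ} {l : E} (hd : Monotone d)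
    (hd' : Tendsto d atTop atTop) (hv : ∀ n, v (n + 1) - v n = (d (n + 1) - d n) • z n)
    (hz : Tendsto z atTop (𝓝 l)) : Tendsto (fun n => (d n)⁻¹ • v n) atTop (𝓝 l) := by
  have hs : ∀ n, ∑ i ∈ Finset.range n, (d (i + 1) - d i) = d n - d 0 :=
    fun n => Finset.sum_range_sub d n
  have h1 : (fun n => (d (n + 1) - d n) • (z n - l)) =o[atTop] fun n => d (n + 1) - d n := by
    have : (fun n => z n - l) =o[atTop] fun _ => (1 : ℝ) := by
      rw [Asymptotics.isLittleO_one_iff]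
      simpa using hz.sub_const l
    simpa using (Asymptotics.isBigO_refl (fun n => d (n + 1) - d n) atTop).smul_isLittleO this
  have h2 := h1.sum_range (fun n => sub_nonneg.2 (hd n.le_succ)) (by
    simp only [hs]; exact tendsto_atTop_add_const_right _ _ hd')
  have e : ∀ n, ∑ i ∈ Finset.range n, (d (i + 1) - d i) • (z i - l)
      = v n - v 0 - (d n - d 0) • l := fun n => by
    simp only [smul_sub, ← hv]
    rw [Finset.sum_sub_distrib, Finset.sum_range_sub v, ← Finset.sum_smul, hs]
  simp only [hs, e] at h2
  have h3 : (fun n => d n - d 0) =O[atTop] d :=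
    (Asymptotics.isBigO_refl d atTop).sub
      (Asymptotics.isLittleO_const_left.2 (Or.inr (tendsto_norm_atTop_atTop.comp hd'))).isBigO
  have h4 := h2.trans_isBigO h3
  have h5 : Tendsto (fun n => (d n)⁻¹ • (v n - v 0 - (d n - d 0) • l)) atTop (𝓝 0) :=
    h4.tendsto_inv_smul_nhds_zero
  have h6 : Tendsto (fun n => (d n)⁻¹) atTop (𝓝 0) := hd'.inv_tendsto_atTop
  have h7 := (h5.add (h6.smul_const (v 0 - d 0 • l))).add_const l
  simp only [zero_smul, zero_add] at h7
  refine h7.congr' ?_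
  filter_upwards [hd'.eventually_gt_atTop 0] with n hn
  rw [← smul_add]
  have : v n - v 0 - (d n - d 0) • l + (v 0 - d 0 • l) = v n - d n • l := by
    rw [sub_smul]; abel
  rw [this, smul_sub, smul_smul, inv_mul_cancel₀ hn.ne', one_smul, sub_add_cancel]

/-- A linear recursion with forcing `y` and noise `ξ`, normalised by a divergent multiple `d` of
the homogeneous solution. -/
lemma tendsto_recursion_of_forcing {r : ℝ} (hr : 0 ≤ r) {x y ξ : ℕ → E} {d b : ℕ → ℝ} {γ : ℝ}
    {w S : E} (hx : ∀ n, x (n + 1) = (1 + r / ((n : ℝ) + 1)) • x n + ((n : ℝ) + 1)⁻¹ • y n + ξ n)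
    (hd : StrictMono d) (hd0 : ∀ n, 0 < d n) (hd' : Tendsto d atTop atTop)
    (hb : ∀ n, 0 < b n) (hγ : γ ≠ 0)
    (hdb : Tendsto (fun n : ℕ => (d (n + 1) - d n) /
      (b n / (((n : ℝ) + 1) * riseProd r (n + 1)))) atTop (𝓝 γ))
    (hy : Tendsto (fun n => (b n)⁻¹ • y n) atTop (𝓝 w))
    (hξ : Tendsto (fun n => ∑ l ∈ Finset.range n, (riseProd r (l + 1) * d (l + 1))⁻¹ • ξ l) atTop
      (𝓝 S)) :
    Tendsto (fun n => (riseProd r n * d n)⁻¹ • x n) atTop (𝓝 (γ⁻¹ • w)) := by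
  set T : ℕ → E := fun n => ∑ l ∈ Finset.range n, (riseProd r (l + 1) * d (l + 1))⁻¹ • ξ l with hT
  have hz := ((hdb.inv₀ hγ).smul hy).sub hξ
  -- Summation by parts, as in Kronecker's lemma: subtracting `d n • T n` replaces the noise in the
  -- increments by `-(d (n+1) - d n) • T n`. Stolz–Cesàro then gives the limit `γ⁻¹ • w - S`, and
  -- adding `T n` back cancels `S`.
  have key := tendsto_inv_smul_of_increments (v := fun n => (riseProd r n)⁻¹ • x n - d n • T n)
    hd.monotone hd' (fun n => ?_) hz
  · have h2 := key.add hξ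
    rw [sub_add_cancel] at h2
    refine h2.congr fun n => ?_
    rw [smul_sub, smul_smul, smul_smul, inv_mul_cancel₀ (hd0 n).ne', one_smul, sub_add_cancel,
      mul_inv_rev]
  · have hp := (riseProd_pos hr (n + 1)).ne'
    have hp' := (riseProd_pos hr n).ne'
    have hdn := (sub_pos.2 (hd n.lt_succ_self)).ne'
    have hbn := (hb n).ne'
    have hd1 := (hd0 (n + 1)).ne'
    have hTs : T (n + 1) = T n + (riseProd r (n + 1) * d (n + 1))⁻¹ • ξ n :=
      Finset.sum_range_succ _ _
    rw [hTs, hx n]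
    simp only [smul_add, smul_sub, smul_smul, sub_smul]
    have e1 : (riseProd r (n + 1))⁻¹ * (1 + r / ((n : ℝ) + 1)) = (riseProd r n)⁻¹ := by
      have : 1 + r / ((n : ℝ) + 1) ≠ 0 := by positivity
      rw [riseProd_succ]; field_simp
    have e2 : d (n + 1) * (riseProd r (n + 1) * d (n + 1))⁻¹ = (riseProd r (n + 1))⁻¹ := by
      field_simp
    have e3 : (d (n + 1) - d n) * (((d (n + 1) - d n) /
        (b n / (((n : ℝ) + 1) * riseProd r (n + 1))))⁻¹ * (b n)⁻¹)
        = (riseProd r (n + 1))⁻¹ * ((n : ℝ) + 1)⁻¹ := by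
      have : (n : ℝ) + 1 ≠ 0 := by positivity
      field_simp
    rw [e1, e2, e3]
    abel

/-- Forcing of smaller order than the homogeneous solution is summable after normalisation. -/
lemma summable_forcing_of_lt [CompleteSpace E] {r r' : ℝ} (hr' : 0 ≤ r') (hr : r' < r)
    {y : ℕ → E} {w : E} (hy : Tendsto (fun n => (riseProd r' n)⁻¹ • y n) atTop (𝓝 w)) :
    Summable fun n : ℕ => (((n : ℝ) + 1) * riseProd r (n + 1))⁻¹ • y n := by
  obtain ⟨C, hC⟩ := (Metric.isBounded_range_of_tendsto _ hy).exists_norm_le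
  refine Summable.of_norm_bounded ((summable_riseProd_div hr' hr).mul_left C) fun n => ?_
  have h1 := hC _ (Set.mem_range_self n)
  have h2 := riseProd_pos hr' n
  have h3 := riseProd_pos (hr'.trans hr.le) (n + 1)
  rw [norm_smul, norm_inv, Real.norm_of_nonneg h2.le, inv_mul_le_iff₀ h2] at h1
  rw [norm_smul, norm_inv, Real.norm_of_nonneg (by positivity), inv_mul_le_iff₀ (by positivity)]
  refine h1.trans (le_of_eq ?_)
  field_simp

/-- A linear recursion normalised by its homogeneous solution converges when the forcing is
summable. -/
lemma exists_tendsto_recursion_of_summable {r : ℝ} (hr0 : 0 ≤ r)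
    {x y ξ : ℕ → E} {S : E}
    (hx : ∀ n, x (n + 1) = (1 + r / ((n : ℝ) + 1)) • x n + ((n : ℝ) + 1)⁻¹ • y n + ξ n)
    (hsum : Summable fun n : ℕ => (((n : ℝ) + 1) * riseProd r (n + 1))⁻¹ • y n)
    (hξ : Tendsto (fun n => ∑ l ∈ Finset.range n, (riseProd r (l + 1))⁻¹ • ξ l) atTop (𝓝 S)) :
    ∃ L, Tendsto (fun n => (riseProd r n)⁻¹ • x n) atTop (𝓝 L) := by
  -- Variation of constants: after division by `riseProd r n` the recursion becomes a sum of its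
  -- increments, starting from `x 0` since `riseProd r 0 = 1`.
  refine ⟨x 0 + ∑' n : ℕ, (((n : ℝ) + 1) * riseProd r (n + 1))⁻¹ • y n + S, ?_⟩
  refine ((hsum.hasSum.tendsto_sum_nat.const_add (x 0)).add hξ).congr fun n => ?_
  induction n with
  | zero => simp [riseProd_zero]
  | succ n ih =>
    have e1 : (riseProd r (n + 1))⁻¹ * (1 + r / ((n : ℝ) + 1)) = (riseProd r n)⁻¹ := by
      have : 1 + r / ((n : ℝ) + 1) ≠ 0 := by positivity
      have := (riseProd_pos hr0 n).ne'
      rw [riseProd_succ]; field_simp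
    rw [Finset.sum_range_succ, Finset.sum_range_succ, hx n]
    simp only [smul_add, smul_smul]
    rw [e1, ← ih, mul_inv_rev]
    abel

/-- The forcing is of larger order than the homogeneous solution. -/
lemma tendsto_recursion_of_lt {r r' : ℝ} (hr : 0 ≤ r) (h : r < r') (s : ℕ) {x y ξ : ℕ → E}
    {w S : E} (hx : ∀ n, x (n + 1) = (1 + r / ((n : ℝ) + 1)) • x n + ((n : ℝ) + 1)⁻¹ • y n + ξ n)
    (hy : Tendsto (fun n => (scale r' s n)⁻¹ • y n) atTop (𝓝 w))
    (hξ : Tendsto (fun n => ∑ l ∈ Finset.range n, (scale r' s (l + 1))⁻¹ • ξ l) atTop (𝓝 S)) :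
    Tendsto (fun n => (scale r' s n)⁻¹ • x n) atTop (𝓝 ((r' - r)⁻¹ • w)) := by
  have hr' : 0 ≤ r' := hr.trans h.le
  have p1 := riseProd_pos hr
  have p2 := scale_pos hr' s
  set d : ℕ → ℝ := fun n => scale r' s n / riseProd r n with hd
  have hd0 : ∀ n, 0 < d n := fun n => div_pos (p2 n) (p1 n)
  have hdm : ∀ n, riseProd r n * d n = scale r' s n := fun n => by
    have := (p1 n).ne'
    simp only [hd]; field_simp
  -- The ratio of increments splits exactly: the powers of `n` contribute `r' - r`, while the
  -- logarithmic factor contributes a term of order `1 / harm n`, which vanishes in the limit.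
  have hstep : ∀ n, (d (n + 1) - d n) / (scale r' s n / (((n : ℝ) + 1) * riseProd r (n + 1))) =
      (n + 1 + r') * ((harm (n + 1) / harm n) ^ s - 1) + (r' - r) := fun n => by
    have h1 := (p1 n).ne'
    have h2 := (riseProd_pos hr' n).ne'
    have h3 := (harm_pos n).ne'
    have h4 : (n : ℝ) + 1 ≠ 0 := by positivity
    have h5 : (n : ℝ) + 1 + r ≠ 0 := by positivity
    have e : ∀ c : ℝ, 1 + c / ((n : ℝ) + 1) = ((n : ℝ) + 1 + c) / ((n : ℝ) + 1) := fun c => by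
      field_simp
    simp only [hd, scale, riseProd_succ, div_pow, e]
    field_simp
    ring
  have hmono : StrictMono d := strictMono_nat_of_lt_succ fun n => by
    have h1 : 0 < scale r' s n / (((n : ℝ) + 1) * riseProd r (n + 1)) :=
      div_pos (p2 n) (mul_pos (by positivity) (p1 _))
    have h2 : 1 ≤ (harm (n + 1) / harm n) ^ s := by
      refine one_le_pow₀ ((one_le_div (harm_pos n)).2 ?_)
      rw [harm_succ]
      linarith [show 0 < 1 / ((n : ℝ) + 1) by positivity]
    have h3 : 0 < (d (n + 1) - d n) / (scale r' s n / (((n : ℝ) + 1) * riseProd r (n + 1))) := by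
      rw [hstep]
      have : 0 ≤ (n + 1 + r') * ((harm (n + 1) / harm n) ^ s - 1) :=
        mul_nonneg (by positivity) (by linarith)
      linarith
    exact sub_pos.1 ((div_pos_iff_of_pos_right h1).1 h3)
  have htop : Tendsto d atTop atTop := by
    have h1 := tendsto_scale_div_scale hr hr' (s := 0) (s' := s) (Or.inl h)
    have h2 : Tendsto (fun n => scale r 0 n / scale r' s n) atTop (𝓝[>] 0) :=
      tendsto_nhdsWithin_iff.2 ⟨h1, Eventually.of_forall fun n =>
        div_pos (scale_pos hr 0 n) (p2 n)⟩
    refine h2.inv_tendsto_nhdsGT_zero.congr fun n => ?_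
    simp [hd, scale]
  have hlim : Tendsto (fun n : ℕ => (d (n + 1) - d n) /
      (scale r' s n / (((n : ℝ) + 1) * riseProd r (n + 1)))) atTop (𝓝 (r' - r)) := by
    simp only [hstep]
    have h1 : Tendsto (fun n : ℕ => (1 + r' * (1 / ((n : ℝ) + 1))) * (harm n)⁻¹) atTop (𝓝 0) := by
      have h0 := ((tendsto_one_div_add_atTop_nhds_zero_nat (𝕜 := ℝ)).const_mul r').const_add 1
      simpa using h0.mul tendsto_harm_atTop.inv_tendsto_atTop
    have h2 := (h1.mul (tendsto_harm_pow_ratio s)).add_const (r' - r)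
    rw [zero_mul, zero_add] at h2
    refine h2.congr fun n => ?_
    have h3 := (harm_pos n).ne'
    have h4 : (n : ℝ) + 1 ≠ 0 := by positivity
    field_simp
  have := tendsto_recursion_of_forcing hr (d := d) (b := scale r' s) hx hmono hd0 htop p2
    (sub_pos.2 h).ne' hlim hy (by simpa only [hdm] using hξ)
  simpa only [hdm] using this

/-- The resonant case: the forcing is of the order of the homogeneous solution, up to logarithms. -/
lemma tendsto_recursion_resonant {r : ℝ} (hr : 0 ≤ r) (s : ℕ) {x y ξ : ℕ → E}
    {w S : E} (hx : ∀ n, x (n + 1) = (1 + r / ((n : ℝ) + 1)) • x n + ((n : ℝ) + 1)⁻¹ • y n + ξ n)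
    (hy : Tendsto (fun n => (scale r s n)⁻¹ • y n) atTop (𝓝 w))
    (hξ : Tendsto (fun n => ∑ l ∈ Finset.range n, (scale r (s + 1) (l + 1))⁻¹ • ξ l) atTop
      (𝓝 S)) :
    Tendsto (fun n => (scale r (s + 1) n)⁻¹ • x n) atTop (𝓝 (((s : ℝ) + 1)⁻¹ • w)) := by
  have hlt : ∀ n, harm n < harm (n + 1) := fun n => by
    rw [harm_succ]
    linarith [show 0 < 1 / ((n : ℝ) + 1) by positivity]
  have hlim : Tendsto (fun n : ℕ => (harm (n + 1) ^ (s + 1) - harm n ^ (s + 1)) /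
      (scale r s n / (((n : ℝ) + 1) * riseProd r (n + 1)))) atTop (𝓝 ((s : ℝ) + 1)) := by
    have h0 := ((tendsto_one_div_add_atTop_nhds_zero_nat (𝕜 := ℝ)).const_mul r).const_add 1
    have h2 := h0.mul (tendsto_harm_pow_ratio (s + 1))
    simp only [mul_zero, add_zero, one_mul] at h2
    push_cast at h2
    refine h2.congr fun n => ?_
    have h3 := (harm_pos n).ne'
    have h4 : (n : ℝ) + 1 ≠ 0 := by positivity
    have h5 := (riseProd_pos hr n).ne'
    simp only [scale, riseProd_succ, div_pow]
    field_simp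
    ring
  exact tendsto_recursion_of_forcing hr (d := fun n => harm n ^ (s + 1)) (b := scale r s) hx
    (strictMono_nat_of_lt_succ fun n => pow_lt_pow_left₀ (hlt n) (harm_pos n).le s.succ_ne_zero)
    (fun n => pow_pos (harm_pos n) _) ((tendsto_pow_atTop s.succ_ne_zero).comp tendsto_harm_atTop)
    (scale_pos hr s) (by positivity) hlim hy hξ

end Normed

/-! ### Combinatorics of the running maxima, and the block eigenvectors -/

section Blocks

variable {K J : ℕ} {R : Matrix (Fin (K + 1)) (Fin (K + 1)) ℝ} {i : Fin (J + 1) → Fin (K + 1)}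

lemma IsRunningMaxima.le_leadEntry (hi : IsRunningMaxima R i) (j : Fin (J + 1))
    {m : Fin (K + 1)} (h : m ≤ i j) : R m m ≤ leadEntry R i j := by
  have : i j ∈ {k | ∀ m, m < k → R m m ≤ R k k} := hi.range_eq ▸ Set.mem_range_self j
  rcases h.lt_or_eq with h | rfl
  · exact this m h
  · exact le_rfl

lemma IsRunningMaxima.leadEntry_mono (hi : IsRunningMaxima R i) : Monotone (leadEntry R i) :=
  fun _ _ h => hi.le_leadEntry _ (hi.strictMono.monotone h)

lemma IsRunningMaxima.exists_eq (hi : IsRunningMaxima R i) {k : Fin (K + 1)}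
    (h : ∀ m, m < k → R m m ≤ R k k) : ∃ j, i j = k := by
  have : k ∈ Set.range i := hi.range_eq ▸ h
  exact this

lemma IsRunningMaxima.apply_zero (hi : IsRunningMaxima R i) : i 0 = 0 := by
  obtain ⟨j, hj⟩ := hi.exists_eq (k := 0) fun m hm => absurd hm (Fin.not_lt_zero m)
  have := hi.strictMono.monotone (Fin.zero_le j)
  rw [hj] at this
  exact le_antisymm this (Fin.zero_le _)

lemma IsRunningMaxima.exists_block (hi : IsRunningMaxima R i) (k : Fin (K + 1)) :
    ∃ j, i j ≤ k ∧ ∀ j', j < j' → k < i j' := by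
  classical
  have hne : (Finset.univ.filter fun j => i j ≤ k).Nonempty :=
    ⟨0, by simp [hi.apply_zero]⟩
  refine ⟨_, (Finset.mem_filter.1 (Finset.max'_mem _ hne)).2, fun j' hj' => ?_⟩
  by_contra hk
  exact absurd (Finset.le_max' _ j' (by simpa using hk)) (not_le.2 hj')

/-- The index of the block that contains a colour. -/
noncomputable def IsRunningMaxima.block (hi : IsRunningMaxima R i) (k : Fin (K + 1)) :
    Fin (J + 1) := (hi.exists_block k).choose

lemma IsRunningMaxima.lead_block_le (hi : IsRunningMaxima R i) (k : Fin (K + 1)) :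
    i (hi.block k) ≤ k := (hi.exists_block k).choose_spec.1

lemma IsRunningMaxima.block_eq_iff (hi : IsRunningMaxima R i) {k : Fin (K + 1)}
    {j : Fin (J + 1)} : hi.block k = j ↔ i j ≤ k ∧ ∀ j', j < j' → k < i j' := by
  have h := (hi.exists_block k).choose_spec
  refine ⟨?_, fun h' => ?_⟩
  · rintro rfl; exact h
  · rcases lt_trichotomy (hi.block k) j with h1 | h1 | h1
    · exact absurd (h.2 _ h1) (not_lt.2 h'.1)
    · exact h1
    · exact absurd (h'.2 _ h1) (not_lt.2 h.1)

lemma IsRunningMaxima.block_lead (hi : IsRunningMaxima R i) (j : Fin (J + 1)) :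
    hi.block (i j) = j := hi.block_eq_iff.2 ⟨le_rfl, fun _ h => hi.strictMono h⟩

lemma IsRunningMaxima.block_mono (hi : IsRunningMaxima R i) : Monotone hi.block := by
  intro k l hkl
  by_contra h
  exact absurd ((hi.block_eq_iff.1 rfl).2 _ (not_le.1 h))
    (not_lt.2 ((hi.lead_block_le k).trans hkl))

/-- Otherwise `k` would itself be a running maximum, hence the leading colour of its block. -/
lemma IsRunningMaxima.lt_leadEntry (hi : IsRunningMaxima R i) {k : Fin (K + 1)}
    {j : Fin (J + 1)} (hk : hi.block k = j) (hne : k ≠ i j) : R k k < leadEntry R i j := by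
  by_contra h
  rw [not_lt] at h
  -- Every earlier entry is dominated by a running maximum at or before it, and each running maximum
  -- before `k` leads a block up to the `j`-th, so its entry is at most `λ_j`.
  have hall : ∀ n : ℕ, ∀ m : Fin (K + 1), m.1 = n → m < k → R m m ≤ R k k := by
    intro n
    induction n using Nat.strong_induction_on with
    | _ n ih =>
      rintro m rfl hm
      by_cases hm' : ∀ l, l < m → R l l ≤ R m m
      · obtain ⟨j', rfl⟩ := hi.exists_eq hm'
        have : j' ≤ j := by rw [← hi.block_lead j', ← hk]; exact hi.block_mono hm.le
        exact (hi.leadEntry_mono this).trans h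
      · push Not at hm'
        obtain ⟨l, hl, hl'⟩ := hm'
        exact hl'.le.trans (ih l hl l rfl (hl.trans hm))
  obtain ⟨j', hj'⟩ := hi.exists_eq fun m hm => hall _ m rfl hm
  rw [← hj', hi.block_lead] at hk
  exact hne (by rw [← hj', hk])

lemma IsRunningMaxima.diag_le (hi : IsRunningMaxima R i) (k : Fin (K + 1)) :
    R k k ≤ leadEntry R i (hi.block k) := by
  by_cases h : k = i (hi.block k)
  · conv_lhs => rw [h]
    rfl
  · exact (hi.lt_leadEntry rfl h).le

lemma IsRunningMaxima.multIndex_eq_zero (hi : IsRunningMaxima R i) {j : Fin (J + 1)}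
    (h : ∀ j', j' < j → leadEntry R i j' < leadEntry R i j) : multIndex R i j = 0 := by
  rw [multIndex, Nat.card_eq_zero]
  refine Or.inl ⟨fun ⟨m, hm, hm'⟩ => ?_⟩
  have h1 : hi.block m < j := by
    rw [← hi.block_lead j]
    refine lt_of_le_of_ne (hi.block_mono hm.le) fun h => ?_
    have := hi.lead_block_le m
    rw [h, hi.block_lead] at this
    exact absurd hm (not_lt.2 this)
  exact absurd ((hi.diag_le m).trans_lt (h _ h1)) (by rw [hm']; exact lt_irrefl _)

lemma IsRunningMaxima.multIndex_succ_of_lt (hi : IsRunningMaxima R i) {j : Fin J}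
    (h : leadEntry R i j.castSucc < leadEntry R i j.succ) : multIndex R i j.succ = 0 :=
  hi.multIndex_eq_zero fun _ hj' =>
    (hi.leadEntry_mono (Fin.le_castSucc_iff.2 hj')).trans_lt h

lemma IsRunningMaxima.multIndex_zero (hi : IsRunningMaxima R i) : multIndex R i 0 = 0 :=
  hi.multIndex_eq_zero fun j' hj' => absurd hj' (Fin.not_lt_zero j')

/-- By strictness inside the block, its leading colour is the only one there with diagonal entry
`λ_j`, so passing to the next leading colour adds exactly one index. -/
lemma IsRunningMaxima.multIndex_succ_of_eq (hi : IsRunningMaxima R i) {j : Fin J}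
    (h : leadEntry R i j.castSucc = leadEntry R i j.succ) :
    multIndex R i j.succ = multIndex R i j.castSucc + 1 := by
  classical
  simp only [multIndex, Nat.card_eq_fintype_card, Fintype.card_subtype]
  have : (Finset.univ.filter fun m => m < i j.succ ∧ R m m = leadEntry R i j.succ) =
      insert (i j.castSucc)
        (Finset.univ.filter fun m => m < i j.castSucc ∧ R m m = leadEntry R i j.castSucc) := by
    ext m
    simp only [Finset.mem_filter, Finset.mem_univ, true_and, Finset.mem_insert, h]
    constructor
    · rintro ⟨h1, h2⟩
      by_contra hc
      push Not at hc
      have h3 : i j.castSucc ≤ m := by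
        by_contra h4
        exact hc.2 (not_le.1 h4) h2
      have h4 : hi.block m = j.castSucc := hi.block_eq_iff.2 ⟨h3, fun j' hj' =>
        h1.trans_le (hi.strictMono.monotone (Fin.castSucc_lt_iff_succ_le.1 hj'))⟩
      exact absurd (hi.lt_leadEntry h4 hc.1) (by rw [h2, h]; exact lt_irrefl _)
    · have hlt : i j.castSucc < i j.succ := hi.strictMono (Fin.castSucc_lt_succ)
      rintro (rfl | ⟨h1, h2⟩)
      · exact ⟨hlt, h⟩
      · exact ⟨h1.trans hlt, h2⟩
  rw [this, Finset.card_insert_of_notMem (by simp)]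

lemma IsRunningMaxima.leadEntry_eq_of_multIndex_pos (hi : IsRunningMaxima R i) {j : Fin J}
    (h : 0 < multIndex R i j.succ) : leadEntry R i j.castSucc = leadEntry R i j.succ := by
  by_contra hne
  exact h.ne' (hi.multIndex_succ_of_lt
    (lt_of_le_of_ne (hi.leadEntry_mono Fin.castSucc_lt_succ.le) hne))

/-- The growth orders of the blocks increase lexicographically. -/
lemma IsRunningMaxima.order_lt (hi : IsRunningMaxima R i) {j j' : Fin (J + 1)} (h : j < j') :
    leadEntry R i j < leadEntry R i j' ∨
      leadEntry R i j = leadEntry R i j' ∧ multIndex R i j < multIndex R i j' := by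
  have hmono : StrictMono fun j => toLex (leadEntry R i j, multIndex R i j) := by
    refine Fin.strictMono_iff_lt_succ.2 fun j => ?_
    rw [Prod.Lex.toLex_lt_toLex]
    rcases (hi.leadEntry_mono (Fin.castSucc_lt_succ (i := j)).le).lt_or_eq with h | h
    · exact Or.inl h
    · exact Or.inr ⟨h, (Nat.lt_succ_self _).trans_eq (hi.multIndex_succ_of_eq h).symm⟩
  exact Prod.Lex.toLex_lt_toLex.1 (hmono h)

variable (hR_nonneg : ∀ a b, 0 ≤ R a b) (hR_row : ∀ a, ∑ b, R a b = 1)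
  (hR_tri : ∀ a b, b < a → R a b = 0)

include hR_nonneg in
lemma leadEntry_nonneg (j : Fin (J + 1)) : 0 ≤ leadEntry R i j := hR_nonneg _ _

include hR_nonneg hR_row in
lemma entry_le_one (a b : Fin (K + 1)) : R a b ≤ 1 := by
  rw [← hR_row a]
  exact Finset.single_le_sum (fun b _ => hR_nonneg a b) (Finset.mem_univ b)

include hR_row hR_tri in
lemma last_entry_eq_one : R (Fin.last K) (Fin.last K) = 1 := by
  rw [← hR_row (Fin.last K)]
  refine (Finset.sum_eq_single (f := fun b => R (Fin.last K) b) (Fin.last K)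
    (fun b _ hb => hR_tri _ _ ?_)
    fun h => absurd (Finset.mem_univ _) h).symm
  exact lt_of_le_of_ne (Fin.le_last b) hb

include hR_nonneg hR_row hR_tri in
lemma IsRunningMaxima.apply_last (hi : IsRunningMaxima R i) : i (Fin.last J) = Fin.last K := by
  obtain ⟨j, hj⟩ := hi.exists_eq (k := Fin.last K) fun m _ => by
    rw [last_entry_eq_one hR_row hR_tri]; exact entry_le_one hR_nonneg hR_row _ _
  have := hi.strictMono.monotone (Fin.le_last j)
  rw [hj] at this
  exact le_antisymm (Fin.le_last _) this

include hR_nonneg hR_row in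
lemma offDiag_eq_zero {k l : Fin (K + 1)} (h : R k k = 1) (hl : l ≠ k) : R k l = 0 := by
  have h1 := hR_row k
  rw [← Finset.add_sum_erase _ _ (Finset.mem_univ k), h] at h1
  have h2 : ∑ b ∈ Finset.univ.erase k, R k b = 0 := by linarith
  exact (Finset.sum_eq_zero_iff_of_nonneg fun b _ => hR_nonneg k b).1 h2 l (by simp [hl])

include hR_nonneg hR_row in
-- If the entry were `1`, the leading row would vanish off the diagonal and feed nothing to the
-- colour just after it. This contradicts `InIncreasingOrder` if that colour belongs to the same
-- block, and `UniqueArrangement` if it leads the next block, whose diagonal entry is then also `1`.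
lemma IsRunningMaxima.leadEntry_lt_one (hi : IsRunningMaxima R i) (h_incr : InIncreasingOrder R i)
    (h_uniq : UniqueArrangement R i) {j : Fin (J + 1)} (hj : j ≠ Fin.last J) :
    leadEntry R i j < 1 := by
  refine lt_of_le_of_ne (entry_le_one hR_nonneg hR_row _ _) fun h => ?_
  obtain ⟨j, rfl⟩ := Fin.exists_castSucc_eq.2 hj
  have hlt : i j.castSucc < i j.succ := hi.strictMono Fin.castSucc_lt_succ
  have h0 : ∀ l, l ≠ i j.castSucc → R (i j.castSucc) l = 0 := fun l hl =>
    offDiag_eq_zero hR_nonneg hR_row h hl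
  have hK : (i j.castSucc : ℕ) + 1 < K + 1 := by
    have : (i j.castSucc).1 < (i j.succ).1 := hlt
    have := (i j.succ).2
    omega
  set k : Fin (K + 1) := ⟨i j.castSucc + 1, hK⟩ with hk
  have hk1 : i j.castSucc < k := by simp [hk, Fin.lt_def]
  have hI : Finset.Ico (i j.castSucc) k = {i j.castSucc} := by
    ext m
    simp only [Finset.mem_Ico, Finset.mem_singleton, Fin.le_def, Fin.lt_def, Fin.ext_iff, hk]
    omega
  rcases lt_or_eq_of_le (show k ≤ i j.succ by simpa [Fin.le_def, hk] using hlt) with h1 | h1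
  · have := h_incr j k hk1 h1
    rw [hI, Finset.sum_singleton, h0 k hk1.ne'] at this
    exact lt_irrefl _ this
  · have h2 : R (i j.succ) (i j.succ) = 1 :=
      le_antisymm (entry_le_one hR_nonneg hR_row _ _)
        (h ▸ hi.leadEntry_mono (Fin.castSucc_lt_succ (i := j)).le)
    have := h_uniq j ((show R (i j.castSucc) (i j.castSucc) = 1 from h).trans h2.symm)
    rw [← h1, hI, Finset.sum_singleton, h0 k hk1.ne'] at this
    exact lt_irrefl _ this

/-- The left eigenvector of the block led by `a`, extended by zero before `a`. -/
noncomputable def eigenRow (R : Matrix (Fin (K + 1)) (Fin (K + 1)) ℝ) (a : Fin (K + 1))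
    (k : Fin (K + 1)) : ℝ :=
  if k = a then 1 else if k < a then 0 else
    (R a a - R k k)⁻¹ * ∑ m : {m : Fin (K + 1) // m < k}, eigenRow R a m.1 * R m.1 k
termination_by k
decreasing_by exact m.2

lemma eigenRow_self (a : Fin (K + 1)) : eigenRow R a a = 1 := by rw [eigenRow]; simp

lemma eigenRow_of_lt {a k : Fin (K + 1)} (h : k < a) : eigenRow R a k = 0 := by
  rw [eigenRow]; simp [h, h.ne]

lemma eigenRow_of_gt {a k : Fin (K + 1)} (h : a < k) :
    eigenRow R a k = (R a a - R k k)⁻¹ * ∑ m ∈ Finset.Iio k, eigenRow R a m * R m k := by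
  rw [eigenRow, if_neg h.ne', if_neg h.not_gt]
  congr 1
  exact (Finset.sum_subtype _ (fun m => by simp) (fun m => eigenRow R a m * R m k)).symm

lemma sum_block_eq (hi : IsRunningMaxima R i) (j : Fin (J + 1)) (f : Fin (K + 1) → ℝ) :
    ∑ m : Block i j, f m.1 = ∑ m, if hi.block m = j then f m else 0 := by
  classical
  rw [← Finset.sum_filter]
  exact (Finset.sum_subtype _ (fun m => by simp [hi.block_eq_iff]) f).symm

include hR_tri in
-- The eigenvector equation is triangular, so its coordinates are determined successively: at a
-- non-leading `k` the coefficient `λ_j - r_k` is nonzero, and at the leading colour the equation is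
-- trivial, leaving the normalisation free.
lemma isNormalizedLeftEigenvector_iff (hi : IsRunningMaxima R i) (j : Fin (J + 1))
    (p : Block i j → ℝ) :
    IsNormalizedLeftEigenvector R i j p ↔ p = fun k => eigenRow R (i j) k.1 := by
  classical
  have hblk : ∀ k : Block i j, hi.block k.1 = j := fun k => hi.block_eq_iff.2 k.2
  have hmul : ∀ (q : Fin (K + 1) → ℝ) (k : Block i j),
      Matrix.vecMul (fun m : Block i j => q m.1) (blockMatrix R i j) k =
        ∑ m ∈ Finset.Iio k.1, (if hi.block m = j then q m * R m k.1 else 0) +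
          q k.1 * R k.1 k.1 := by
    intro q k
    have h1 : Matrix.vecMul (fun m : Block i j => q m.1) (blockMatrix R i j) k =
        ∑ m : Block i j, q m.1 * R m.1 k.1 := rfl
    rw [h1, sum_block_eq hi j fun m => q m * R m k.1]
    rw [← Finset.sum_subset (Finset.subset_univ (Finset.Iic k.1)), ← Finset.Iio_insert,
      Finset.sum_insert (by simp), if_pos (hblk k), add_comm]
    intro m _ hm
    rw [Finset.mem_Iic, not_le] at hm
    simp [hR_tri _ _ hm]
  have hzero : ∀ k : Block i j, k.1 = i j → ∀ q : Fin (K + 1) → ℝ,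
      ∑ m ∈ Finset.Iio k.1, (if hi.block m = j then q m * R m k.1 else 0) = 0 := by
    intro k hk q
    refine Finset.sum_eq_zero fun m hm => if_neg fun hm' => ?_
    rw [Finset.mem_Iio, hk] at hm
    exact absurd (hm' ▸ hi.lead_block_le m) (not_le.2 hm)
  have hgt : ∀ k : Block i j, k.1 ≠ i j → i j < k.1 := fun k hk => lt_of_le_of_ne k.2.1 hk.symm
  have hsub : ∀ k : Block i j, k.1 ≠ i j → R (i j) (i j) - R k.1 k.1 ≠ 0 := fun k hk =>
    (sub_pos.2 (hi.lt_leadEntry (hblk k) hk)).ne'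
  constructor
  · rintro ⟨h1, h2⟩
    -- Extension by zero to all colours, so that sums over the block become sums over initial
    -- segments.
    obtain ⟨q, rfl⟩ : ∃ q : Fin (K + 1) → ℝ, p = fun m => q m.1 :=
      ⟨fun k => if h : i j ≤ k ∧ ∀ j', j < j' → k < i j' then p ⟨k, h⟩ else 0, by
        ext m; simp [m.2.1]; intro x hx hx'; exact absurd hx' (not_le.2 (m.2.2 x hx))⟩
    have key : ∀ n : ℕ, ∀ k : Block i j, k.1.1 = n → q k.1 = eigenRow R (i j) k.1 := by
      intro n
      induction n using Nat.strong_induction_on with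
      | _ n ih =>
        rintro k rfl
        by_cases hk : k.1 = i j
        · have := h2 k hk
          simp only at this
          rw [this, hk, eigenRow_self]
        · have h3 := congrFun h1 k
          rw [hmul, Pi.smul_apply, smul_eq_mul] at h3
          rw [eigenRow_of_gt (hgt k hk), eq_inv_mul_iff_mul_eq₀ (hsub k hk)]
          have h4 : ∑ m ∈ Finset.Iio k.1, eigenRow R (i j) m * R m k.1 =
              ∑ m ∈ Finset.Iio k.1, (if hi.block m = j then q m * R m k.1 else 0) := by
            refine Finset.sum_congr rfl fun m hm => ?_
            rw [Finset.mem_Iio] at hm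
            split_ifs with hb
            · rw [← ih m hm ⟨m, hi.block_eq_iff.1 hb⟩ rfl]
            · have : m < i j := by
                by_contra hc
                exact hb (hi.block_eq_iff.2 ⟨not_lt.1 hc, fun j' hj' => hm.trans (k.2.2 j' hj')⟩)
              rw [eigenRow_of_lt this, zero_mul]
          rw [h4]
          rw [leadEntry] at h3
          linear_combination -h3
    ext k
    exact key _ k rfl
  · rintro rfl
    refine ⟨?_, fun k hk => by simp only [hk, eigenRow_self]⟩
    ext k
    rw [hmul, Pi.smul_apply, smul_eq_mul]
    by_cases hk : k.1 = i j
    · rw [hzero k hk, hk, leadEntry]; ring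
    · have h3 := eigenRow_of_gt (R := R) (hgt k hk)
      rw [eq_inv_mul_iff_mul_eq₀ (hsub k hk)] at h3
      have h4 : ∑ m ∈ Finset.Iio k.1, eigenRow R (i j) m * R m k.1 =
          ∑ m ∈ Finset.Iio k.1, (if hi.block m = j then eigenRow R (i j) m * R m k.1 else 0) := by
        refine Finset.sum_congr rfl fun m hm => ?_
        rw [Finset.mem_Iio] at hm
        split_ifs with hb
        · rfl
        · have : m < i j := by
            by_contra hc
            exact hb (hi.block_eq_iff.2 ⟨not_lt.1 hc, fun j' hj' => hm.trans (k.2.2 j' hj')⟩)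
          rw [eigenRow_of_lt this, zero_mul]
      rw [← h4, ← h3, leadEntry]
      ring

end Blocks

/-! ### Deterministic asymptotics of the urn recursion -/

section Asymptotics

variable {K J : ℕ} {R : Matrix (Fin (K + 1)) (Fin (K + 1)) ℝ} {i : Fin (J + 1) → Fin (K + 1)}

/-- The growth order of the `j`-th block, in a form suited to the urn recursion. -/
noncomputable def blockScale (R : Matrix (Fin (K + 1)) (Fin (K + 1)) ℝ)
    (i : Fin (J + 1) → Fin (K + 1)) (j : Fin (J + 1)) (n : ℕ) : ℝ :=
  scale (leadEntry R i j) (multIndex R i j) n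

lemma blockScale_pos (hR : ∀ a b, 0 ≤ R a b) (j : Fin (J + 1)) (n : ℕ) :
    0 < blockScale R i j n := scale_pos (leadEntry_nonneg hR j) _ _

lemma IsRunningMaxima.tendsto_blockScale_ratio (hi : IsRunningMaxima R i)
    (hR : ∀ a b, 0 ≤ R a b) {j j' : Fin (J + 1)} (h : j < j') :
    Tendsto (fun n => blockScale R i j n / blockScale R i j' n) atTop (𝓝 0) :=
  tendsto_scale_div_scale (leadEntry_nonneg hR j) (leadEntry_nonneg hR j') (hi.order_lt h)

variable {E : Type*} [NormedAddCommGroup E] [NormedSpace ℝ E]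

/-- The recursion satisfied by the composition of the urn: its mean drift, plus noise `ξ`. -/
def IsUrnRecursion (R : Matrix (Fin (K + 1)) (Fin (K + 1)) ℝ) (x ξ : ℕ → Fin (K + 1) → E) : Prop :=
  ∀ n k, x (n + 1) k = x n k + ((n : ℝ) + 1)⁻¹ • ∑ m, R m k • x n m + ξ n k

lemma IsUrnRecursion.scalar (hR_tri : ∀ a b, b < a → R a b = 0) {x ξ : ℕ → Fin (K + 1) → E}
    (hx : IsUrnRecursion R x ξ) (k : Fin (K + 1)) (n : ℕ) :
    x (n + 1) k = (1 + R k k / ((n : ℝ) + 1)) • x n k +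
      ((n : ℝ) + 1)⁻¹ • ∑ m ∈ Finset.Iio k, R m k • x n m + ξ n k := by
  rw [hx n k, ← Finset.sum_subset (Finset.subset_univ (Finset.Iic k)), ← Finset.Iio_insert,
    Finset.sum_insert (by simp), smul_add, smul_smul, add_smul, one_smul, div_eq_inv_mul]
  · abel
  · intro m _ hm
    rw [Finset.mem_Iic, not_le] at hm
    rw [hR_tri _ _ hm, zero_smul]

/-- Only the colours of the highest block contribute to the limit of a linear combination. -/
lemma IsRunningMaxima.tendsto_forcing (hi : IsRunningMaxima R i) (hR : ∀ a b, 0 ≤ R a b)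
    {x : ℕ → Fin (K + 1) → E} {ℓ : Fin (K + 1) → E} {k : Fin (K + 1)} {j : Fin (J + 1)}
    (hl : ∀ m < k, Tendsto (fun n => (blockScale R i (hi.block m) n)⁻¹ • x n m) atTop (𝓝 (ℓ m)))
    (hj : ∀ m < k, hi.block m ≤ j) :
    Tendsto (fun n => (blockScale R i j n)⁻¹ • ∑ m ∈ Finset.Iio k, R m k • x n m) atTop
      (𝓝 (∑ m ∈ Finset.Iio k, if hi.block m = j then R m k • ℓ m else 0)) := by
  simp only [Finset.smul_sum]
  refine tendsto_finsetSum _ fun m hm => ?_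
  rw [Finset.mem_Iio] at hm
  split_ifs with h
  · refine ((hl m hm).const_smul (R m k)).congr fun n => ?_
    rw [h, smul_comm]
  · have h1 := ((hi.tendsto_blockScale_ratio hR (lt_of_le_of_ne (hj m hm) h)).smul
      (hl m hm)).const_smul (R m k)
    rw [zero_smul, smul_zero] at h1
    refine h1.congr fun n => ?_
    have := (blockScale_pos (i := i) hR (hi.block m) n).ne'
    have e : (blockScale R i j n)⁻¹ =
        blockScale R i (hi.block m) n / blockScale R i j n * (blockScale R i (hi.block m) n)⁻¹ := by
      field_simp
    rw [smul_smul _ _ (x n m), ← e, smul_comm]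

variable {x ξ : ℕ → Fin (K + 1) → E} {ℓ : Fin (K + 1) → E}

/-- Since `r_k < λ_j`, the forcing from the block's own earlier colours outgrows the homogeneous
solution and fixes the limit. -/
lemma IsRunningMaxima.tendsto_nonlead (hi : IsRunningMaxima R i) (hR : ∀ a b, 0 ≤ R a b)
    (hR_tri : ∀ a b, b < a → R a b = 0) (hx : IsUrnRecursion R x ξ) {k : Fin (K + 1)}
    (hξ : ∃ S, Tendsto (fun n => ∑ l ∈ Finset.range n,
      (blockScale R i (hi.block k) (l + 1))⁻¹ • ξ l k) atTop (𝓝 S))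
    (hk : k ≠ i (hi.block k))
    (hl : ∀ m < k, Tendsto (fun n => (blockScale R i (hi.block m) n)⁻¹ • x n m) atTop (𝓝 (ℓ m))) :
    Tendsto (fun n => (blockScale R i (hi.block k) n)⁻¹ • x n k) atTop
      (𝓝 ((leadEntry R i (hi.block k) - R k k)⁻¹ • ∑ m ∈ Finset.Iio k,
        if hi.block m = hi.block k then R m k • ℓ m else 0)) := by
  obtain ⟨S, hS⟩ := hξ
  exact tendsto_recursion_of_lt (hR k k) (hi.lt_leadEntry rfl hk) _ (hx.scalar hR_tri k)
    (hi.tendsto_forcing hR hl fun m hm => hi.block_mono hm.le) hS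

lemma IsRunningMaxima.block_le_castSucc (hi : IsRunningMaxima R i) {j : Fin J} {m : Fin (K + 1)}
    (hm : m < i j.succ) : hi.block m ≤ j.castSucc := by
  rw [Fin.le_castSucc_iff]
  by_contra h
  exact absurd ((hi.strictMono.monotone (not_lt.1 h)).trans (hi.lead_block_le m)) (not_le.2 hm)

/-- Resonance: the previous block grows like the homogeneous solution times `harm n ^ (ν - 1)`, and
summing that against `1 / n` produces `harm n ^ ν / ν`. -/
lemma IsRunningMaxima.tendsto_lead_of_eq (hi : IsRunningMaxima R i) (hR : ∀ a b, 0 ≤ R a b)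
    (hR_tri : ∀ a b, b < a → R a b = 0) (hx : IsUrnRecursion R x ξ) {j : Fin J}
    (hξ : ∃ S, Tendsto (fun n => ∑ l ∈ Finset.range n,
      (blockScale R i j.succ (l + 1))⁻¹ • ξ l (i j.succ)) atTop (𝓝 S))
    (hj : leadEntry R i j.castSucc = leadEntry R i j.succ)
    (hl : ∀ m < i j.succ,
      Tendsto (fun n => (blockScale R i (hi.block m) n)⁻¹ • x n m) atTop (𝓝 (ℓ m))) :
    Tendsto (fun n => (blockScale R i j.succ n)⁻¹ • x n (i j.succ)) atTop
      (𝓝 ((multIndex R i j.succ : ℝ)⁻¹ • ∑ m ∈ Finset.Iio (i j.succ),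
        if hi.block m = j.castSucc then R m (i j.succ) • ℓ m else 0)) := by
  obtain ⟨S, hS⟩ := hξ
  have hf := hi.tendsto_forcing hR hl fun m hm => hi.block_le_castSucc hm
  simp only [blockScale, hi.multIndex_succ_of_eq hj, hj] at hf hS ⊢
  push_cast
  exact tendsto_recursion_resonant (hR _ _) _ (hx.scalar hR_tri (i j.succ)) hf hS

/-- The forcing is of strictly smaller power order than the homogeneous solution, so only existence
of a limit is obtained; this is where a new free limit enters. -/
lemma IsRunningMaxima.exists_tendsto_lead_of_lt [CompleteSpace E] (hi : IsRunningMaxima R i)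
    (hR : ∀ a b, 0 ≤ R a b)
    (hR_tri : ∀ a b, b < a → R a b = 0) (hx : IsUrnRecursion R x ξ) {j : Fin J}
    (hξ : ∃ S, Tendsto (fun n => ∑ l ∈ Finset.range n,
      (blockScale R i j.succ (l + 1))⁻¹ • ξ l (i j.succ)) atTop (𝓝 S))
    (hj : leadEntry R i j.castSucc < leadEntry R i j.succ)
    (hl : ∀ m < i j.succ,
      Tendsto (fun n => (blockScale R i (hi.block m) n)⁻¹ • x n m) atTop (𝓝 (ℓ m))) :
    ∃ L, Tendsto (fun n => (blockScale R i j.succ n)⁻¹ • x n (i j.succ)) atTop (𝓝 L) := by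
  obtain ⟨S, hS⟩ := hξ
  have hf := hi.tendsto_forcing hR hl fun m hm => hi.block_le_castSucc hm
  simp only [blockScale, hi.multIndex_succ_of_lt hj, scale, pow_zero, mul_one] at hS ⊢
  have h0 := leadEntry_nonneg (i := i) hR j.castSucc
  -- An intermediate exponent absorbs the logarithms of the preceding block.
  obtain ⟨r, hr1, hr2⟩ := exists_between hj
  have h1 := (tendsto_scale_div_scale h0 (h0.trans hr1.le)
    (s := multIndex R i j.castSucc) (s' := 0) (Or.inl hr1)).smul hf
  refine exists_tendsto_recursion_of_summable (hR _ _) (hx.scalar hR_tri (i j.succ))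
    (summable_forcing_of_lt (h0.trans hr1.le) hr2 (h1.congr fun n => ?_)) hS
  have h2 := (scale_pos h0 (multIndex R i j.castSucc) n).ne'
  have e : (riseProd r n)⁻¹ = scale (leadEntry R i j.castSucc) (multIndex R i j.castSucc) n /
      scale r 0 n * (scale (leadEntry R i j.castSucc) (multIndex R i j.castSucc) n)⁻¹ := by
    simp only [scale, pow_zero, mul_one] at h2 ⊢
    rw [div_eq_mul_inv, mul_right_comm, mul_inv_cancel₀ h2, one_mul]
  rw [smul_smul, blockScale, ← e]

lemma IsRunningMaxima.exists_tendsto_first (hi : IsRunningMaxima R i)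
    (hR : ∀ a b, 0 ≤ R a b)
    (hR_tri : ∀ a b, b < a → R a b = 0) (hx : IsUrnRecursion R x ξ)
    (hξ : ∃ S, Tendsto (fun n => ∑ l ∈ Finset.range n,
      (blockScale R i 0 (l + 1))⁻¹ • ξ l (i 0)) atTop (𝓝 S)) :
    ∃ L, Tendsto (fun n => (blockScale R i 0 n)⁻¹ • x n (i 0)) atTop (𝓝 L) := by
  obtain ⟨S, hS⟩ := hξ
  simp only [blockScale, hi.multIndex_zero, scale, pow_zero, mul_one] at hS ⊢
  refine exists_tendsto_recursion_of_summable (hR _ _) (hx.scalar hR_tri (i 0)) ?_ hS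
  have : Finset.Iio (i 0) = ∅ := by
    rw [hi.apply_zero]; ext m; simp
  simp [this, summable_zero]

/-- Asymptotics of the urn recursion: every colour, scaled by the growth order of its block,
converges, and the limits are governed by one vector per block. -/
theorem IsRunningMaxima.exists_limits [CompleteSpace E] (hi : IsRunningMaxima R i)
    (hR : ∀ a b, 0 ≤ R a b) (hR_tri : ∀ a b, b < a → R a b = 0) (hx : IsUrnRecursion R x ξ)
    (hξ : ∀ k, ∃ S, Tendsto (fun n => ∑ l ∈ Finset.range n,
      (blockScale R i (hi.block k) (l + 1))⁻¹ • ξ l k) atTop (𝓝 S)) :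
    ∃ L : Fin (J + 1) → E,
      (∀ k, Tendsto (fun n => (blockScale R i (hi.block k) n)⁻¹ • x n k) atTop
        (𝓝 (eigenRow R (i (hi.block k)) k • L (hi.block k)))) ∧
      ∀ j : Fin J, 0 < multIndex R i j.succ → L j.succ = (multIndex R i j.succ : ℝ)⁻¹ •
        (∑ m, if hi.block m = j.castSucc then
          eigenRow R (i j.castSucc) m * R m (i j.succ) else 0) • L j.castSucc := by
  have hξ' : ∀ j, ∃ S, Tendsto (fun n => ∑ l ∈ Finset.range n,
      (blockScale R i j (l + 1))⁻¹ • ξ l (i j)) atTop (𝓝 S) := fun j => by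
    simpa only [hi.block_lead] using hξ (i j)
  have hex : ∀ n : ℕ, ∀ k : Fin (K + 1), k.1 = n → ∃ L,
      Tendsto (fun n => (blockScale R i (hi.block k) n)⁻¹ • x n k) atTop (𝓝 L) := by
    intro n
    induction n using Nat.strong_induction_on with
    | _ n ih =>
      rintro k rfl
      choose! ℓ hl using fun m (hm : m < k) => ih m.1 hm m rfl
      by_cases hk : k = i (hi.block k)
      · obtain ⟨j, hj⟩ : ∃ j, hi.block k = j := ⟨_, rfl⟩
        rw [hj] at hk
        subst hk
        rw [hi.block_lead]
        rcases Fin.eq_zero_or_eq_succ j with rfl | ⟨j, rfl⟩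
        · exact hi.exists_tendsto_first hR hR_tri hx (hξ' 0)
        · rcases (hi.leadEntry_mono (Fin.castSucc_lt_succ (i := j)).le).lt_or_eq with h | h
          · exact hi.exists_tendsto_lead_of_lt hR hR_tri hx (hξ' _) h hl
          · exact ⟨_, hi.tendsto_lead_of_eq hR hR_tri hx (hξ' _) h hl⟩
      · exact ⟨_, hi.tendsto_nonlead hR hR_tri hx (hξ k) hk hl⟩
  choose ℓ hl using fun k => hex _ k rfl
  -- The limits inside a block satisfy the recursion that defines `eigenRow`, so they are multiples
  -- of the limit at the leading colour.
  have hrow : ∀ n : ℕ, ∀ k : Fin (K + 1), k.1 = n →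
      ℓ k = eigenRow R (i (hi.block k)) k • ℓ (i (hi.block k)) := by
    intro n
    induction n using Nat.strong_induction_on with
    | _ n ih =>
      rintro k rfl
      by_cases hk : k = i (hi.block k)
      · rw [← hk, eigenRow_self, one_smul]
      · have h1 := tendsto_nhds_unique (hl k)
          (hi.tendsto_nonlead hR hR_tri hx (hξ k) hk fun m _ => hl m)
        have hlt : i (hi.block k) < k := lt_of_le_of_ne (hi.lead_block_le k) (Ne.symm hk)
        rw [h1, eigenRow_of_gt hlt, ← smul_smul, Finset.sum_smul, leadEntry]
        congr 1
        refine Finset.sum_congr rfl fun m hm => ?_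
        rw [Finset.mem_Iio] at hm
        split_ifs with h
        · rw [ih m hm m rfl, h, smul_smul, mul_comm]
        · have : m < i (hi.block k) := by
            by_contra hc
            refine h (le_antisymm (hi.block_mono hm.le) ?_)
            have := hi.block_mono (not_lt.1 hc)
            rwa [hi.block_lead] at this
          rw [eigenRow_of_lt this, zero_mul, zero_smul]
  refine ⟨fun j => ℓ (i j), fun k => hrow _ k rfl ▸ hl k, fun j hj => ?_⟩
  have h1 := tendsto_nhds_unique (by simpa only [hi.block_lead] using hl (i j.succ))
    (hi.tendsto_lead_of_eq hR hR_tri hx (hξ' _) (hi.leadEntry_eq_of_multIndex_pos hj)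
      fun m _ => hl m)
  beta_reduce
  rw [h1, Finset.sum_smul]
  congr 1
  rw [← Finset.sum_subset (Finset.subset_univ (Finset.Iio (i j.succ)))]
  · refine Finset.sum_congr rfl fun m _ => ?_
    split_ifs with h
    · rw [hrow _ m rfl, h, smul_smul, mul_comm]
    · rw [zero_smul]
  · intro m _ hm
    rw [Finset.mem_Iio, not_lt] at hm
    have := hi.block_mono hm
    rw [hi.block_lead] at this
    rw [if_neg (Fin.castSucc_lt_succ.trans_le this).ne', zero_smul]

end Asymptotics

/-! ### Convergence of orthogonal and martingale series -/

section OrthogonalSeries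

/-- An orthogonal series with summable squared norms converges. -/
lemma exists_tendsto_sum_of_orthogonal {H : Type*} [NormedAddCommGroup H] [InnerProductSpace ℝ H]
    [CompleteSpace H] {f : ℕ → H} (horth : ∀ m n, m < n → inner ℝ (f m) (f n) = 0)
    (hs : Summable fun n => ‖f n‖ ^ 2) :
    ∃ S, Tendsto (fun n => ∑ l ∈ Finset.range n, f l) atTop (𝓝 S) := by
  have horth' : ∀ m n, m ≠ n → inner ℝ (f m) (f n) = 0 := fun m n h => by
    rcases lt_or_gt_of_ne h with h | h
    · exact horth m n h
    · rw [real_inner_comm]; exact horth n m h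
  have hsq : ∀ s : Finset ℕ, ‖∑ l ∈ s, f l‖ ^ 2 = ∑ l ∈ s, ‖f l‖ ^ 2 := fun s => by
    rw [← real_inner_self_eq_norm_sq, sum_inner]
    refine Finset.sum_congr rfl fun l hl => ?_
    rw [inner_sum, Finset.sum_eq_single_of_mem l hl fun b _ hb => horth' l b hb.symm,
      real_inner_self_eq_norm_sq]
  have : Summable f := by
    rw [summable_iff_vanishing_norm] at hs ⊢
    intro ε hε
    obtain ⟨s, hs'⟩ := hs (ε ^ 2) (by positivity)
    refine ⟨s, fun t ht => ?_⟩
    have h1 := hs' t ht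
    rw [← hsq, Real.norm_of_nonneg (by positivity)] at h1
    exact lt_of_pow_lt_pow_left₀ 2 hε.le h1
  exact ⟨_, this.hasSum.tendsto_sum_nat⟩

variable {Ω : Type*} {m0 : MeasurableSpace Ω} {μ : Measure Ω}

lemma sum_toLp {ι : Type*} (s : Finset ι) {f : ι → Ω → ℝ} (hf : ∀ l, MemLp (f l) 2 μ) :
    ∑ l ∈ s, (hf l).toLp = (memLp_finsetSum s fun l _ => hf l).toLp (fun ω => ∑ l ∈ s, f l ω) := by
  classical
  induction s using Finset.induction_on with
  | empty =>
    simp only [Finset.sum_empty]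
    exact (MemLp.toLp_zero _).symm
  | insert a s ha ih =>
    rw [Finset.sum_insert ha, ih, ← MemLp.toLp_add]
    refine (MemLp.toLp_eq_toLp_iff _ _).2 (Eventually.of_forall fun ω => ?_)
    simp [Finset.sum_insert ha]

lemma norm_toLp_sq {f : Ω → ℝ} (hf : MemLp f 2 μ) : ‖hf.toLp‖ ^ 2 = ∫ ω, f ω ^ 2 ∂μ := by
  rw [← real_inner_self_eq_norm_sq, L2.inner_def]
  refine integral_congr_ae ?_
  filter_upwards [hf.coeFn_toLp] with ω h
  rw [h, real_inner_self_eq_norm_sq, Real.norm_eq_abs, sq_abs]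

variable [IsProbabilityMeasure μ]

lemma integral_mul_eq_zero_of_condExp {m : MeasurableSpace Ω} (hm : m ≤ m0) {f g : Ω → ℝ}
    (hf : StronglyMeasurable[m] f) (hg : Integrable g μ) {c : ℝ} (hfc : ∀ ω, |f ω| ≤ c)
    (h0 : μ[g | m] =ᵐ[μ] 0) : ∫ ω, f ω * g ω ∂μ = 0 := by
  have h1 := condExp_stronglyMeasurable_mul_of_bound hm hf hg c
    (Eventually.of_forall hfc)
  have h2 : ∫ ω, (f * g) ω ∂μ = 0 := by
    rw [← integral_condExp hm, integral_congr_ae h1]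
    refine (integral_congr_ae (g := 0) ?_).trans (by simp)
    filter_upwards [h0] with ω h
    simp [h]
  exact h2

/-- Bounded martingale differences with summable variances have an almost surely and `L²`
convergent series. -/
lemma exists_tendsto_sum_martingale_diff {ℱ : Filtration ℕ m0} {ζ : ℕ → Ω → ℝ} {c : ℕ → ℝ}
    (hmeas : ∀ l, StronglyMeasurable[ℱ (l + 1)] (ζ l)) (hbd : ∀ l ω, |ζ l ω| ≤ c l)
    (hcond : ∀ l, μ[ζ l | ℱ l] =ᵐ[μ] 0) (hL : ∀ l, MemLp (ζ l) 2 μ)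
    (hs : Summable fun l => ∫ ω, ζ l ω ^ 2 ∂μ) :
    (∀ᵐ ω ∂μ, ∃ S, Tendsto (fun n => ∑ l ∈ Finset.range n, ζ l ω) atTop (𝓝 S)) ∧
      ∃ S, Tendsto (fun n => ∑ l ∈ Finset.range n, (hL l).toLp) atTop (𝓝 S) := by
  have hint : ∀ l, Integrable (ζ l) μ := fun l => (hL l).integrable (by norm_num)
  have hconv : ∃ S, Tendsto (fun n => ∑ l ∈ Finset.range n, (hL l).toLp) atTop (𝓝 S) := by
    refine exists_tendsto_sum_of_orthogonal (fun m n hmn => ?_) (by simpa only [norm_toLp_sq])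
    rw [L2.inner_def, ← integral_mul_eq_zero_of_condExp (ℱ.le n)
      ((hmeas m).mono (ℱ.mono hmn)) (hint n) (hbd m) (hcond n)]
    refine integral_congr_ae ?_
    filter_upwards [(hL m).coeFn_toLp, (hL n).coeFn_toLp] with ω h1 h2
    rw [h1, h2]
    simp [mul_comm]
  refine ⟨?_, hconv⟩
  obtain ⟨S, hS⟩ := hconv
  obtain ⟨C, hC⟩ := (Metric.isBounded_range_of_tendsto _ hS).exists_norm_le
  have hmart : Martingale (fun n ω => ∑ l ∈ Finset.range n, ζ l ω) ℱ μ := by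
    refine martingale_of_condExp_sub_eq_zero_nat (fun n => ?_)
      (fun n => integrable_finsetSum _ fun l _ => hint l) fun n => ?_
    · exact Finset.stronglyMeasurable_fun_sum _ fun l hl =>
        (hmeas l).mono (ℱ.mono (Finset.mem_range.1 hl))
    · have : (fun ω => ∑ l ∈ Finset.range (n + 1), ζ l ω) -
          (fun ω => ∑ l ∈ Finset.range n, ζ l ω) = ζ n := by
        ext ω; simp [Finset.sum_range_succ]
      rw [this]
      exact hcond n
  -- The convergent `L²` partial sums are bounded in `L²`, hence in `L¹` as `μ` is a probability
  -- measure, and martingale convergence applies.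
  refine hmart.submartingale.exists_ae_tendsto_of_bdd (R := C.toNNReal) fun n => ?_
  refine (eLpNorm_le_eLpNorm_of_exponent_le (q := 2) (by norm_num)
    (integrable_finsetSum _ fun l _ => hint l).aestronglyMeasurable).trans ?_
  have h1 := hC _ (Set.mem_range_self n)
  rw [sum_toLp, Lp.norm_toLp] at h1
  have h2 : eLpNorm (fun ω => ∑ l ∈ Finset.range n, ζ l ω) 2 μ ≠ ⊤ :=
    (memLp_finsetSum _ fun l _ => hL l).2.ne
  rw [← ENNReal.ofReal_toReal h2]
  exact ENNReal.ofReal_le_ofReal h1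

end OrthogonalSeries

/-! ### The urn composition, its noise and its conditional means -/

section Composition

variable {K J : ℕ} {R : Matrix (Fin (K + 1)) (Fin (K + 1)) ℝ} {i : Fin (J + 1) → Fin (K + 1)}
  {c₀ : Fin (K + 1) → ℝ} {Ω : Type*} {draw : ℕ → Ω → Fin (K + 1)}

/-- The difference between the balls of colour `k` added at a draw and their conditional mean. -/
noncomputable def urnNoise (R : Matrix (Fin (K + 1)) (Fin (K + 1)) ℝ) (c₀ : Fin (K + 1) → ℝ)
    (draw : ℕ → Ω → Fin (K + 1)) (n : ℕ) (ω : Ω) (k : Fin (K + 1)) : ℝ :=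
  R (draw n ω) k - ((n : ℝ) + 1)⁻¹ * ∑ m, R m k * urnCount R c₀ draw n ω m

lemma urnCount_succ (n : ℕ) (ω : Ω) (k : Fin (K + 1)) :
    urnCount R c₀ draw (n + 1) ω k = urnCount R c₀ draw n ω k + R (draw n ω) k := rfl

lemma isUrnRecursion_urnCount (ω : Ω) :
    IsUrnRecursion R (fun n k => urnCount R c₀ draw n ω k) (fun n k => urnNoise R c₀ draw n ω k) :=
  fun n k => by
    simp only [urnCount_succ, urnNoise, smul_eq_mul]
    ring

lemma urnCount_nonneg (hR : ∀ a b, 0 ≤ R a b) (hc : ∀ k, 0 < c₀ k) (n : ℕ) (ω : Ω)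
    (k : Fin (K + 1)) : 0 ≤ urnCount R c₀ draw n ω k := by
  induction n with
  | zero => exact (hc k).le
  | succ n ih => exact add_nonneg ih (hR _ _)

lemma sum_urnCount (hR_row : ∀ a, ∑ b, R a b = 1) (hc : ∑ k, c₀ k = 1) (n : ℕ) (ω : Ω) :
    ∑ k, urnCount R c₀ draw n ω k = n + 1 := by
  induction n with
  | zero => simpa [urnCount] using hc
  | succ n ih =>
    simp only [urnCount_succ, Finset.sum_add_distrib, ih, hR_row]
    push_cast
    ring

lemma urnCount_le (hR : ∀ a b, 0 ≤ R a b) (hR_row : ∀ a, ∑ b, R a b = 1) (hc : ∀ k, 0 < c₀ k)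
    (hc_sum : ∑ k, c₀ k = 1) (n : ℕ) (ω : Ω) (k : Fin (K + 1)) :
    urnCount R c₀ draw n ω k ≤ n + 1 := by
  rw [← sum_urnCount (draw := draw) hR_row hc_sum n ω]
  exact Finset.single_le_sum (fun k _ => urnCount_nonneg hR hc n ω k) (Finset.mem_univ k)

lemma urnMean_nonneg (hR : ∀ a b, 0 ≤ R a b) (hc : ∀ k, 0 < c₀ k) (n : ℕ) (ω : Ω)
    (k : Fin (K + 1)) : 0 ≤ ((n : ℝ) + 1)⁻¹ * ∑ m, R m k * urnCount R c₀ draw n ω m :=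
  mul_nonneg (by positivity)
    (Finset.sum_nonneg fun m _ => mul_nonneg (hR m k) (urnCount_nonneg hR hc n ω m))

lemma urnMean_le_one (hR : ∀ a b, 0 ≤ R a b) (hR_row : ∀ a, ∑ b, R a b = 1) (hc : ∀ k, 0 < c₀ k)
    (hc_sum : ∑ k, c₀ k = 1) (n : ℕ) (ω : Ω) (k : Fin (K + 1)) :
    ((n : ℝ) + 1)⁻¹ * ∑ m, R m k * urnCount R c₀ draw n ω m ≤ 1 := by
  rw [inv_mul_le_iff₀ (by positivity), mul_one, ← sum_urnCount (draw := draw) hR_row hc_sum n ω]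
  exact Finset.sum_le_sum fun m _ => mul_le_of_le_one_left (urnCount_nonneg hR hc n ω m)
    (entry_le_one hR hR_row m k)

lemma abs_urnNoise_le_one (hR : ∀ a b, 0 ≤ R a b) (hR_row : ∀ a, ∑ b, R a b = 1)
    (hc : ∀ k, 0 < c₀ k) (hc_sum : ∑ k, c₀ k = 1) (n : ℕ) (ω : Ω) (k : Fin (K + 1)) :
    |urnNoise R c₀ draw n ω k| ≤ 1 := by
  have h1 := urnMean_nonneg (draw := draw) hR hc n ω k
  have h2 := urnMean_le_one (draw := draw) hR hR_row hc hc_sum n ω k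
  have h3 := hR (draw n ω) k
  have h4 := entry_le_one hR hR_row (draw n ω) k
  rw [urnNoise, abs_le]
  constructor <;> linarith

variable [m0 : MeasurableSpace Ω] {μ : Measure Ω}

/-- The filtration generated by the draws. -/
def IsUrnProcess.filtration (h : IsUrnProcess μ R c₀ draw) : Filtration ℕ m0 where
  seq := drawHistory draw
  mono' _ _ hab := iSup₂_le fun s hs => le_iSup₂_of_le (f := fun s (_ : s ∈ Finset.range _) =>
    MeasurableSpace.comap (draw s) ⊤) s
    (Finset.mem_range.2 ((Finset.mem_range.1 hs).trans_le hab)) le_rfl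
  le' _ := iSup₂_le fun s _ => (h.measurable s).comap_le

lemma IsUrnProcess.measurable_draw (h : IsUrnProcess μ R c₀ draw) (n : ℕ) :
    Measurable[h.filtration (n + 1)] (draw n) :=
  Measurable.of_comap_le (le_iSup₂_of_le (f := fun s (_ : s ∈ Finset.range _) =>
    MeasurableSpace.comap (draw s) ⊤) n (by simp) le_rfl)

lemma IsUrnProcess.stronglyMeasurable_entry (h : IsUrnProcess μ R c₀ draw) (n : ℕ)
    (k : Fin (K + 1)) : StronglyMeasurable[h.filtration (n + 1)] fun ω => R (draw n ω) k :=
  Measurable.stronglyMeasurable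
    ((Measurable.of_discrete (f := fun a => R a k)).comp (h.measurable_draw n))

lemma IsUrnProcess.stronglyMeasurable_urnCount (h : IsUrnProcess μ R c₀ draw) (n : ℕ)
    (k : Fin (K + 1)) :
    StronglyMeasurable[h.filtration n] fun ω => urnCount R c₀ draw n ω k := by
  induction n with
  | zero => exact stronglyMeasurable_const
  | succ n ih =>
    exact (ih.mono (h.filtration.mono n.le_succ)).add (h.stronglyMeasurable_entry n k)

lemma IsUrnProcess.stronglyMeasurable_urnMean (h : IsUrnProcess μ R c₀ draw) (n : ℕ)
    (k : Fin (K + 1)) : StronglyMeasurable[h.filtration n] fun ω =>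
      ((n : ℝ) + 1)⁻¹ * ∑ m, R m k * urnCount R c₀ draw n ω m :=
  StronglyMeasurable.const_mul (Finset.stronglyMeasurable_fun_sum _ fun m _ =>
    (h.stronglyMeasurable_urnCount n m).const_mul (R m k)) _

lemma IsUrnProcess.stronglyMeasurable_urnNoise (h : IsUrnProcess μ R c₀ draw) (n : ℕ)
    (k : Fin (K + 1)) :
    StronglyMeasurable[h.filtration (n + 1)] fun ω => urnNoise R c₀ draw n ω k :=
  (h.stronglyMeasurable_entry n k).sub
    ((h.stronglyMeasurable_urnMean n k).mono (h.filtration.mono n.le_succ))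

section Standing

variable [IsProbabilityMeasure μ] (hR : ∀ a b, 0 ≤ R a b) (hR_row : ∀ a, ∑ b, R a b = 1)
  (hc : ∀ k, 0 < c₀ k) (hc_sum : ∑ k, c₀ k = 1) (h : IsUrnProcess μ R c₀ draw)
include hR hR_row hc hc_sum h

lemma memLp_urnCount (n : ℕ) (k : Fin (K + 1)) :
    MemLp (fun ω => urnCount R c₀ draw n ω k) 2 μ :=
  MemLp.of_bound
    ((h.stronglyMeasurable_urnCount n k).mono (h.filtration.le n)).aestronglyMeasurable
    (n + 1) (Eventually.of_forall fun ω => by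
      rw [Real.norm_of_nonneg (urnCount_nonneg hR hc n ω k)]
      exact urnCount_le hR hR_row hc hc_sum n ω k)

lemma memLp_urnNoise (n : ℕ) (k : Fin (K + 1)) :
    MemLp (fun ω => urnNoise R c₀ draw n ω k) 2 μ :=
  MemLp.of_bound
    (((h.stronglyMeasurable_urnNoise n k).mono (h.filtration.le (n + 1))).aestronglyMeasurable)
    1 (Eventually.of_forall fun ω => abs_urnNoise_le_one hR hR_row hc hc_sum n ω k)

lemma integrable_urnCount (n : ℕ) (k : Fin (K + 1)) :
    Integrable (fun ω => urnCount R c₀ draw n ω k) μ :=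
  (memLp_urnCount hR hR_row hc hc_sum h n k).integrable (by norm_num)

lemma integrable_urnNoise (n : ℕ) (k : Fin (K + 1)) :
    Integrable (fun ω => urnNoise R c₀ draw n ω k) μ :=
  (memLp_urnNoise hR hR_row hc hc_sum h n k).integrable (by norm_num)

lemma integrable_urnMean (n : ℕ) (k : Fin (K + 1)) :
    Integrable (fun ω => ((n : ℝ) + 1)⁻¹ * ∑ m, R m k * urnCount R c₀ draw n ω m) μ :=
  (integrable_finsetSum _ fun m _ =>
    (integrable_urnCount hR hR_row hc hc_sum h n m).const_mul _).const_mul _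

lemma condExp_urnNoise (n : ℕ) (k : Fin (K + 1)) :
    μ[fun ω => urnNoise R c₀ draw n ω k | h.filtration n] =ᵐ[μ] 0 := by
  have hind : ∀ m, Integrable ((draw n ⁻¹' {m}).indicator fun _ => (1 : ℝ)) μ := fun m =>
    (integrable_const (1 : ℝ)).indicator (h.measurable n (measurableSet_singleton m))
  have e1 : (fun ω => R (draw n ω) k) =
      ∑ m, R m k • (draw n ⁻¹' {m}).indicator fun _ => (1 : ℝ) := by
    ext ω
    rw [Finset.sum_apply, Finset.sum_eq_single (draw n ω)]
    · simp
    · intro m _ hm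
      simp [hm.symm]
    · simp
  have hi1 : Integrable (fun ω => R (draw n ω) k) μ := by
    rw [e1]; exact integrable_finsetSum' _ fun m _ => (hind m).smul _
  have h1 : μ[fun ω => R (draw n ω) k | h.filtration n] =ᵐ[μ]
      fun ω => ((n : ℝ) + 1)⁻¹ * ∑ m, R m k * urnCount R c₀ draw n ω m := by
    rw [e1]
    refine (condExp_finsetSum (fun m _ => (hind m).smul _) _).trans ?_
    have h2 : ∀ᵐ ω ∂μ, ∀ m, (μ[R m k • (draw n ⁻¹' {m}).indicator fun _ => (1 : ℝ) |
        h.filtration n]) ω = R m k * (urnCount R c₀ draw n ω m / ((n : ℝ) + 1)) := by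
      rw [ae_all_iff]
      intro m
      filter_upwards [condExp_smul (R m k) ((draw n ⁻¹' {m}).indicator fun _ => (1 : ℝ))
        (h.filtration n), h.condProb n m] with ω h3 h4
      rw [h3, Pi.smul_apply, smul_eq_mul]
      congr 1
    filter_upwards [h2] with ω h2
    simp only [Finset.sum_apply, h2, Finset.mul_sum]
    refine Finset.sum_congr rfl fun m _ => ?_
    ring
  have h3 := condExp_sub hi1 (integrable_urnMean hR hR_row hc hc_sum h n k) (h.filtration n)
  rw [condExp_of_stronglyMeasurable (h.filtration.le n) (h.stronglyMeasurable_urnMean n k)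
    (integrable_urnMean hR hR_row hc hc_sum h n k)] at h3
  filter_upwards [h3, h1] with ω h4 h5
  refine h4.trans ?_
  rw [Pi.sub_apply, h5]
  simp

lemma setIntegral_urnNoise {s : Set Ω} {n : ℕ} (hs : MeasurableSet[h.filtration n] s)
    (k : Fin (K + 1)) : ∫ ω in s, urnNoise R c₀ draw n ω k ∂μ = 0 := by
  rw [← setIntegral_condExp (h.filtration.le n) (integrable_urnNoise hR hR_row hc hc_sum h n k) hs]
  refine (setIntegral_congr_ae (g := 0) (h.filtration.le n _ hs) ?_).trans (by simp)
  filter_upwards [condExp_urnNoise hR hR_row hc hc_sum h n k] with ω h1 _ using h1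

/-- The noise integrates to zero over any event known at time `n`, so the noiseless recursion
remains. It is used on the whole space for the means and on the events fixing the first draw for
nondegeneracy. -/
lemma setIntegral_urnCount_succ {s : Set Ω} {n : ℕ} (hs : MeasurableSet[h.filtration n] s)
    (k : Fin (K + 1)) : ∫ ω in s, urnCount R c₀ draw (n + 1) ω k ∂μ =
      ∫ ω in s, urnCount R c₀ draw n ω k ∂μ +
        ((n : ℝ) + 1)⁻¹ • ∑ m, R m k • ∫ ω in s, urnCount R c₀ draw n ω m ∂μ := by
  have hi := fun m => (integrable_urnCount hR hR_row hc hc_sum h n m).integrableOn (s := s)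
  have e : ∀ ω, urnCount R c₀ draw (n + 1) ω k = urnCount R c₀ draw n ω k +
      ((n : ℝ) + 1)⁻¹ * ∑ m, R m k * urnCount R c₀ draw n ω m + urnNoise R c₀ draw n ω k :=
    fun ω => by simpa using isUrnRecursion_urnCount (R := R) (c₀ := c₀) (draw := draw) ω n k
  simp only [e]
  have hi2 := (integrable_urnMean hR hR_row hc hc_sum h n k).integrableOn (s := s)
  have hi3 : IntegrableOn (fun ω => urnCount R c₀ draw n ω k +
      ((n : ℝ) + 1)⁻¹ * ∑ m, R m k * urnCount R c₀ draw n ω m) s μ := (hi k).add hi2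
  rw [integral_add hi3 (integrable_urnNoise hR hR_row hc hc_sum h n k).integrableOn,
    integral_add (hi k) hi2, setIntegral_urnNoise hR hR_row hc hc_sum h hs, integral_const_mul,
    integral_finsetSum _ fun m _ => (hi m).const_mul _]
  simp only [integral_const_mul, smul_eq_mul, add_zero]

/-- For an increment in `[0, 1]` the conditional variance is at most the conditional mean. A bound
in terms of the mean composition is needed because the trivial bound `1` is not summable after
normalisation when `λ ≤ 1/2`. -/
lemma integral_urnNoise_sq_le (n : ℕ) (k : Fin (K + 1)) :
    ∫ ω, urnNoise R c₀ draw n ω k ^ 2 ∂μ ≤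
      ((n : ℝ) + 1)⁻¹ * ∑ m, R m k * ∫ ω, urnCount R c₀ draw n ω m ∂μ := by
  set g : Ω → ℝ := fun ω => ((n : ℝ) + 1)⁻¹ * ∑ m, R m k * urnCount R c₀ draw n ω m with hg
  have hg0 : ∀ ω, 0 ≤ g ω := fun ω => urnMean_nonneg hR hc n ω k
  have hg1 : ∀ ω, g ω ≤ 1 := fun ω =>
    urnMean_le_one hR hR_row hc hc_sum n ω k
  have hgi : Integrable g μ := integrable_urnMean hR hR_row hc hc_sum h n k
  have hni := integrable_urnNoise hR hR_row hc hc_sum h n k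
  have hng : ∫ ω, g ω * urnNoise R c₀ draw n ω k ∂μ = 0 :=
    integral_mul_eq_zero_of_condExp (h.filtration.le n) (h.stronglyMeasurable_urnMean n k)
      hni (c := 1) (fun ω => by rw [abs_of_nonneg (hg0 ω)]; exact hg1 ω)
      (condExp_urnNoise hR hR_row hc hc_sum h n k)
  have hn0 : ∫ ω, urnNoise R c₀ draw n ω k ∂μ = 0 := by
    simpa using setIntegral_urnNoise hR hR_row hc hc_sum h (s := Set.univ) (n := n)
      MeasurableSet.univ k
  have hgni : Integrable (fun ω => g ω * urnNoise R c₀ draw n ω k) μ :=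
    hni.bdd_mul hgi.aestronglyMeasurable
      (c := 1) (Eventually.of_forall fun ω => by
        rw [Real.norm_of_nonneg (hg0 ω)]; exact hg1 ω)
  -- With `A = ξ + g` in `[0, 1]`, the inequality `A² ≤ A` gives `ξ² ≤ ξ - 2gξ + g - g²`; the terms
  -- in `ξ` and `gξ` have zero mean.
  have hmain : ∫ ω, urnNoise R c₀ draw n ω k ^ 2 ∂μ ≤
      ∫ ω, ((urnNoise R c₀ draw n ω k - 2 * (g ω * urnNoise R c₀ draw n ω k)) + g ω) ∂μ := by
    refine integral_mono (memLp_urnNoise hR hR_row hc hc_sum h n k).integrable_sq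
      ((hni.sub (hgni.const_mul 2)).add hgi) fun ω => ?_
    have e : urnNoise R c₀ draw n ω k = R (draw n ω) k - g ω := rfl
    have h3 := hR (draw n ω) k
    have h4 := entry_le_one hR hR_row (draw n ω) k
    simp only [e]
    nlinarith [hg0 ω]
  refine hmain.trans (le_of_eq ?_)
  have hi3 : Integrable (fun ω => urnNoise R c₀ draw n ω k -
      2 * (g ω * urnNoise R c₀ draw n ω k)) μ := hni.sub (hgni.const_mul 2)
  rw [integral_add hi3 hgi, integral_sub hni (hgni.const_mul 2),
    integral_const_mul, hng, hn0, hg, integral_const_mul, integral_finsetSum _ fun m _ =>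
      (integrable_urnCount hR hR_row hc hc_sum h n m).const_mul _]
  simp only [integral_const_mul]
  ring

end Standing

end Composition

/-! ### Summability of the normalised variances -/

section Variance

variable {K J : ℕ} {R : Matrix (Fin (K + 1)) (Fin (K + 1)) ℝ} {i : Fin (J + 1) → Fin (K + 1)}

lemma riseProd_mono {r : ℝ} (hr : 0 ≤ r) : Monotone (riseProd r) :=
  monotone_nat_of_le_succ fun n => by
    rw [riseProd_succ]
    exact le_mul_of_one_le_right (riseProd_pos hr n).le
      (by linarith [show 0 ≤ r / ((n : ℝ) + 1) by positivity])

lemma scale_mono {r : ℝ} (hr : 0 ≤ r) (s : ℕ) : Monotone (scale r s) := fun _ _ h =>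
  mul_le_mul (riseProd_mono hr h) (pow_le_pow_left₀ (harm_pos _).le (harm_mono h) s)
    (pow_pos (harm_pos _) s).le (riseProd_pos hr _).le

/-- The contribution of colour `m` to the variance of the noise of colour `k` is summable. -/
lemma IsRunningMaxima.summable_variance (hi : IsRunningMaxima R i) (hR : ∀ a b, 0 ≤ R a b)
    (hR_tri : ∀ a b, b < a → R a b = 0) (m k : Fin (K + 1)) :
    Summable fun n : ℕ => R m k * (blockScale R i (hi.block m) n /
      (((n : ℝ) + 1) * blockScale R i (hi.block k) (n + 1) ^ 2)) := by
  by_cases hRmk : R m k = 0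
  · simp only [hRmk, zero_mul]; exact summable_zero
  refine Summable.mul_left _ ?_
  have hmk : m ≤ k := by
    by_contra hc
    exact hRmk (hR_tri _ _ (not_le.1 hc))
  have hb := hi.block_mono hmk
  have p := fun j n => blockScale_pos (i := i) hR j n
  -- If `λ > 0`, one factor of the squared scale cancels the mean and the other leaves a series of
  -- order `n ^ (-1-λ)`.
  rcases (leadEntry_nonneg (i := i) hR (hi.block k)).lt_or_eq with hpos | hzero
  · obtain ⟨C, hC⟩ : ∃ C, ∀ n,
        blockScale R i (hi.block m) n / blockScale R i (hi.block k) n ≤ C := by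
      rcases hb.lt_or_eq with hlt | heq
      · obtain ⟨C, hC⟩ := (hi.tendsto_blockScale_ratio hR hlt).bddAbove_range
        exact ⟨C, fun n => hC (Set.mem_range_self n)⟩
      · exact ⟨1, fun n => by rw [heq, div_self (p _ n).ne']⟩
    refine Summable.of_nonneg_of_le (fun n => ?_) (fun n => ?_)
      ((summable_riseProd_div le_rfl hpos).mul_left C)
    · have := p (hi.block m) n; have := p (hi.block k) (n + 1); positivity
    · have h1 := p (hi.block k) n
      have h2 := p (hi.block k) (n + 1)
      have h0 : 0 ≤ C := (div_pos (p _ n) h1).le.trans (hC n)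
      have h3 : blockScale R i (hi.block k) n ≤ blockScale R i (hi.block k) (n + 1) :=
        scale_mono hpos.le _ n.le_succ
      have h4 : riseProd (leadEntry R i (hi.block k)) (n + 1) ≤
          blockScale R i (hi.block k) (n + 1) :=
        le_mul_of_one_le_right (riseProd_pos hpos.le _).le (one_le_pow₀ (one_le_harm _))
      have h5 : riseProd 0 n = 1 := by simp [riseProd]
      have h6 := riseProd_pos hpos.le (n + 1)
      have h7 : blockScale R i (hi.block m) n ≤ C * blockScale R i (hi.block k) (n + 1) :=
        ((div_le_iff₀ h1).1 (hC n)).trans (mul_le_mul_of_nonneg_left h3 h0)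
      calc blockScale R i (hi.block m) n / (((n : ℝ) + 1) * blockScale R i (hi.block k) (n + 1) ^ 2)
          ≤ C * blockScale R i (hi.block k) (n + 1) /
            (((n : ℝ) + 1) * blockScale R i (hi.block k) (n + 1) ^ 2) := by gcongr
        _ = C * (1 / (((n : ℝ) + 1) * blockScale R i (hi.block k) (n + 1))) := by field_simp
        _ ≤ C * (riseProd 0 n /
            (((n : ℝ) + 1) * riseProd (leadEntry R i (hi.block k)) (n + 1))) := by
          rw [h5]; gcongr
  -- If `λ = 0`, colour `k` leads its block and is fed only by strictly earlier blocks, which have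
  -- fewer logarithms: `2 + ν_m ≤ 2 ν_k`, so the series is dominated by that of `1 / (n log² n)`.
  · have hRkk : R k k = 0 := le_antisymm ((hi.diag_le k).trans hzero.ge) (hR k k)
    have hne : m ≠ k := by rintro rfl; exact hRmk hRkk
    have hk : k = i (hi.block k) := by
      by_contra hc
      exact absurd ((hi.lt_leadEntry rfl hc).trans_eq hzero.symm) (not_lt.2 (hR k k))
    have hlt : hi.block m < hi.block k := by
      refine lt_of_le_of_ne hb fun heq => ?_
      have := hi.lead_block_le m
      rw [heq, ← hk] at this
      exact hne (le_antisymm hmk this)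
    rcases hi.order_lt hlt with h1 | ⟨h1, h2⟩
    · exact absurd (h1.trans_eq hzero.symm) (not_lt.2 (leadEntry_nonneg hR _))
    refine Summable.of_nonneg_of_le (fun n => ?_) (fun n => ?_) summable_inv_harm_sq
    · have := p (hi.block m) n; have := p (hi.block k) (n + 1); positivity
    · have e : ∀ s n, scale 0 s n = harm n ^ s := fun s n => by simp [scale, riseProd]
      simp only [blockScale, h1, ← hzero, e]
      have q := harm_pos (n + 1)
      rw [div_le_div_iff₀ (by positivity) (by positivity), one_mul, mul_comm, mul_assoc]
      refine mul_le_mul_of_nonneg_left ?_ (by positivity)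
      calc harm (n + 1) ^ 2 * harm n ^ multIndex R i (hi.block m)
          ≤ harm (n + 1) ^ 2 * harm (n + 1) ^ multIndex R i (hi.block m) :=
            mul_le_mul_of_nonneg_left (pow_le_pow_left₀ (harm_pos n).le (harm_mono n.le_succ) _)
              (by positivity)
        _ = harm (n + 1) ^ (2 + multIndex R i (hi.block m)) := (pow_add _ _ _).symm
        _ ≤ harm (n + 1) ^ (multIndex R i (hi.block k) * 2) :=
            pow_le_pow_right₀ (one_le_harm _) (by omega)
        _ = (harm (n + 1) ^ multIndex R i (hi.block k)) ^ 2 := pow_mul _ _ _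

end Variance

/-! ### Almost sure and mean-square limits -/

section Limits

variable {K J : ℕ} {R : Matrix (Fin (K + 1)) (Fin (K + 1)) ℝ} {i : Fin (J + 1) → Fin (K + 1)}
  {c₀ : Fin (K + 1) → ℝ} {Ω : Type*} {draw : ℕ → Ω → Fin (K + 1)}
  [m0 : MeasurableSpace Ω] {μ : Measure Ω} [IsProbabilityMeasure μ]
  (hR : ∀ a b, 0 ≤ R a b) (hR_row : ∀ a, ∑ b, R a b = 1) (hR_tri : ∀ a b, b < a → R a b = 0)
  (hi : IsRunningMaxima R i)
  (hc : ∀ k, 0 < c₀ k) (hc_sum : ∑ k, c₀ k = 1) (h : IsUrnProcess μ R c₀ draw)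
include hR hR_row hR_tri hc hc_sum h

/-- The means solve the urn recursion without noise, so the deterministic asymptotics already bound
them, before anything is known about the noise. -/
lemma exists_integral_urnCount_le (k : Fin (K + 1)) :
    ∃ C, ∀ n, ∫ ω, urnCount R c₀ draw n ω k ∂μ ≤ C * blockScale R i (hi.block k) n := by
  have hrec : IsUrnRecursion R (fun n k => ∫ ω, urnCount R c₀ draw n ω k ∂μ)
      (fun _ _ => (0 : ℝ)) := fun n k => by
    simpa using setIntegral_urnCount_succ hR hR_row hc hc_sum h (s := Set.univ) (n := n)
      MeasurableSet.univ k
  obtain ⟨L, hL, -⟩ := hi.exists_limits hR hR_tri hrec fun k => ⟨0, by simp⟩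
  obtain ⟨C, hC⟩ := (hL k).bddAbove_range
  refine ⟨C, fun n => ?_⟩
  have h1 := hC (Set.mem_range_self n)
  simp only [smul_eq_mul] at h1
  rwa [inv_mul_le_iff₀ (blockScale_pos hR _ n), mul_comm] at h1

lemma summable_integral_noise_sq (k : Fin (K + 1)) :
    Summable fun n => ∫ ω, ((blockScale R i (hi.block k) (n + 1))⁻¹ *
      urnNoise R c₀ draw n ω k) ^ 2 ∂μ := by
  choose C hC using exists_integral_urnCount_le hR hR_row hR_tri hi hc hc_sum h
  refine Summable.of_nonneg_of_le (fun n => integral_nonneg fun ω => sq_nonneg _) (fun n => ?_)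
    (summable_sum (s := Finset.univ) fun m _ =>
      (hi.summable_variance hR hR_tri m k).mul_left (C m))
  simp only [mul_pow, integral_const_mul]
  have p := blockScale_pos (i := i) hR (hi.block k) (n + 1)
  calc (blockScale R i (hi.block k) (n + 1))⁻¹ ^ 2 * ∫ ω, urnNoise R c₀ draw n ω k ^ 2 ∂μ
      ≤ (blockScale R i (hi.block k) (n + 1))⁻¹ ^ 2 * (((n : ℝ) + 1)⁻¹ *
        ∑ m, R m k * (C m * blockScale R i (hi.block m) n)) := by
        refine mul_le_mul_of_nonneg_left ((integral_urnNoise_sq_le hR hR_row hc hc_sum h n k).trans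
          (mul_le_mul_of_nonneg_left (Finset.sum_le_sum fun m _ =>
            mul_le_mul_of_nonneg_left (hC m n) (hR m k)) (by positivity))) (by positivity)
    _ = _ := by
        simp only [Finset.mul_sum]
        refine Finset.sum_congr rfl fun m _ => ?_
        field_simp

/-- Almost sure and `L²` limits of all colours, scaled by the growth orders of their blocks. -/
theorem exists_urnCount_limits : ∃ L : Fin (J + 1) → Ω → ℝ, (∀ j, MemLp (L j) 2 μ) ∧
    (∀ᵐ ω ∂μ, ∀ k, Tendsto (fun n => urnCount R c₀ draw n ω k / blockScale R i (hi.block k) n)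
      atTop (𝓝 (eigenRow R (i (hi.block k)) k * L (hi.block k) ω))) ∧
    (∀ k, Tendsto (fun n => eLpNorm (fun ω =>
      urnCount R c₀ draw n ω k / blockScale R i (hi.block k) n -
        eigenRow R (i (hi.block k)) k * L (hi.block k) ω) 2 μ) atTop (𝓝 0)) ∧
    ∀ j : Fin J, 0 < multIndex R i j.succ → ∀ᵐ ω ∂μ, L j.succ ω =
      (multIndex R i j.succ : ℝ)⁻¹ * ((∑ m, if hi.block m = j.castSucc then
        eigenRow R (i j.castSucc) m * R m (i j.succ) else 0) * L j.castSucc ω) := by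
  have hX := memLp_urnCount hR hR_row hc hc_sum h
  have hN := memLp_urnNoise hR hR_row hc hc_sum h
  have hζ : ∀ k n, MemLp (fun ω => (blockScale R i (hi.block k) (n + 1))⁻¹ *
      urnNoise R c₀ draw n ω k) 2 μ := fun k n => (hN n k).const_mul _
  have hmart := fun k => exists_tendsto_sum_martingale_diff (ℱ := h.filtration)
    (ζ := fun n ω => (blockScale R i (hi.block k) (n + 1))⁻¹ * urnNoise R c₀ draw n ω k)
    (c := fun n => (blockScale R i (hi.block k) (n + 1))⁻¹)
    (fun n => (h.stronglyMeasurable_urnNoise n k).const_mul _)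
    (fun n ω => by
      have p := inv_pos.2 (blockScale_pos (i := i) hR (hi.block k) (n + 1))
      rw [abs_mul, abs_of_pos p]
      exact mul_le_of_le_one_right p.le (abs_urnNoise_le_one hR hR_row hc hc_sum n ω k))
    (fun n => by
      filter_upwards [condExp_smul (blockScale R i (hi.block k) (n + 1))⁻¹
        (fun ω => urnNoise R c₀ draw n ω k) (h.filtration n),
        condExp_urnNoise hR hR_row hc hc_sum h n k] with ω h1 h2
      refine h1.trans ?_
      rw [Pi.smul_apply, h2, Pi.zero_apply, smul_zero])
    (hζ k) (summable_integral_noise_sq hR hR_row hR_tri hi hc hc_sum h k)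
  have hrecL : IsUrnRecursion R (fun n k => (hX n k).toLp) (fun n k => (hN n k).toLp) := by
    intro n k
    have e1 : ∑ m, R m k • (hX n m).toLp = ∑ m, ((hX n m).const_smul (R m k)).toLp := rfl
    rw [e1, sum_toLp Finset.univ fun m => (hX n m).const_smul (R m k), ← MemLp.toLp_const_smul,
      ← MemLp.toLp_add, ← MemLp.toLp_add]
    refine (MemLp.toLp_eq_toLp_iff _ _).2 (Eventually.of_forall fun ω => ?_)
    exact isUrnRecursion_urnCount (R := R) (c₀ := c₀) (draw := draw) ω n k
  obtain ⟨L, hL, hLrel⟩ := hi.exists_limits hR hR_tri hrecL fun k => (hmart k).2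
  have hptw : ∀ᵐ ω ∂μ, ∃ ℓ : Fin (J + 1) → ℝ,
      (∀ k, Tendsto (fun n => (blockScale R i (hi.block k) n)⁻¹ • urnCount R c₀ draw n ω k) atTop
        (𝓝 (eigenRow R (i (hi.block k)) k • ℓ (hi.block k)))) := by
    filter_upwards [ae_all_iff.2 fun k => (hmart k).1] with ω hω
    obtain ⟨ℓ, hℓ, -⟩ := hi.exists_limits hR hR_tri
      (isUrnRecursion_urnCount (R := R) (c₀ := c₀) (draw := draw) ω) hω
    exact ⟨ℓ, hℓ⟩
  -- Convergence in `L²` gives almost sure convergence along a subsequence at each leading colour,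
  -- which identifies the pathwise limits with the `L²` ones.
  have hsub : ∀ j, ∃ ns : ℕ → ℕ, StrictMono ns ∧ ∀ᵐ ω ∂μ, Tendsto (fun n =>
      (blockScale R i j (ns n))⁻¹ • urnCount R c₀ draw (ns n) ω (i j)) atTop (𝓝 (L j ω)) := by
    intro j
    have h1 := hL (i j)
    rw [hi.block_lead, eigenRow_self, one_smul] at h1
    obtain ⟨ns, hns, h2⟩ := (tendstoInMeasure_of_tendsto_Lp h1).exists_seq_tendsto_ae
    refine ⟨ns, hns, ?_⟩
    filter_upwards [h2, ae_all_iff.2 fun n =>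
      (((hX (ns n) (i j)).const_smul (blockScale R i j (ns n))⁻¹).coeFn_toLp)] with ω h3 h4
    exact h3.congr h4
  choose ns hns hsub using hsub
  refine ⟨fun j => L j, fun j => Lp.memLp (L j), ?_, fun k => ?_, fun j hj => ?_⟩
  · filter_upwards [hptw, ae_all_iff.2 hsub] with ω ⟨ℓ, hℓ⟩ h2 k
    have h3 : ∀ j, ℓ j = L j ω := fun j => by
      have h4 := hℓ (i j)
      rw [hi.block_lead, eigenRow_self, one_smul] at h4
      exact tendsto_nhds_unique (h4.comp (hns j).tendsto_atTop) (h2 j)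
    refine ((h3 (hi.block k)) ▸ hℓ k).congr fun n => ?_
    rw [smul_eq_mul, div_eq_inv_mul]
  · have h1 := (Lp.tendsto_Lp_iff_tendsto_eLpNorm' _ _).1 (hL k)
    refine h1.congr fun n => eLpNorm_congr_ae ?_
    filter_upwards [((hX n k).const_smul (blockScale R i (hi.block k) n)⁻¹).coeFn_toLp,
      Lp.coeFn_smul (eigenRow R (i (hi.block k)) k) (L (hi.block k))] with ω h2 h3
    rw [Pi.sub_apply, h3, Pi.smul_apply, smul_eq_mul]
    congr 1
    refine h2.trans ?_
    rw [Pi.smul_apply, smul_eq_mul, div_eq_inv_mul]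
  · have h1 := hLrel j hj
    rw [smul_smul] at h1
    filter_upwards [Lp.coeFn_smul ((multIndex R i j.succ : ℝ)⁻¹ * ∑ m, if hi.block m = j.castSucc
      then eigenRow R (i j.castSucc) m * R m (i j.succ) else 0) (L j.castSucc)] with ω h2
    rw [h1, h2, Pi.smul_apply, smul_eq_mul, mul_assoc]

end Limits

/-! ### Nondegeneracy through the influence of the first draw -/

section Nondegeneracy

variable {K J : ℕ} {R : Matrix (Fin (K + 1)) (Fin (K + 1)) ℝ} {i : Fin (J + 1) → Fin (K + 1)}
  {c₀ : Fin (K + 1) → ℝ} {Ω : Type*} {draw : ℕ → Ω → Fin (K + 1)}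
  [m0 : MeasurableSpace Ω] {μ : Measure Ω} [IsProbabilityMeasure μ]
  (hR : ∀ a b, 0 ≤ R a b) (hR_row : ∀ a, ∑ b, R a b = 1) (hR_tri : ∀ a b, b < a → R a b = 0)
  (hc : ∀ k, 0 < c₀ k) (hc_sum : ∑ k, c₀ k = 1) (h : IsUrnProcess μ R c₀ draw)

include h in
lemma measureReal_first_draw (a : Fin (K + 1)) : μ.real (draw 0 ⁻¹' {a}) = c₀ a := by
  have h1 := integral_condExp (μ := μ) (f := (draw 0 ⁻¹' {a}).indicator fun _ => (1 : ℝ))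
    (h.filtration.le 0)
  have h2 : μ[(draw 0 ⁻¹' {a}).indicator fun _ => (1 : ℝ) | h.filtration 0] =ᵐ[μ] _ :=
    h.condProb 0 a
  rw [integral_congr_ae h2,
    integral_indicator_const _ (h.measurable 0 (measurableSet_singleton a))] at h1
  simpa [urnCount] using h1.symm

include hR hR_row hR_tri hc hc_sum h in
/-- The mean composition given a first draw of colour `k`, minus that given a first draw of the
last colour, is explicit at colour `k`. -/
lemma integral_urnCount_first_draw_sub {k : Fin (K + 1)} (hk : k ≠ Fin.last K) (n : ℕ) :
    (c₀ k)⁻¹ * ∫ ω in draw 0 ⁻¹' {k}, urnCount R c₀ draw (n + 1) ω k ∂μ -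
      (c₀ (Fin.last K))⁻¹ *
        ∫ ω in draw 0 ⁻¹' {Fin.last K}, urnCount R c₀ draw (n + 1) ω k ∂μ =
      R k k * (riseProd (R k k) (n + 1) / riseProd (R k k) 1) := by
  set δ : ℕ → Fin (K + 1) → ℝ := fun n m =>
    (c₀ k)⁻¹ * ∫ ω in draw 0 ⁻¹' {k}, urnCount R c₀ draw (n + 1) ω m ∂μ -
      (c₀ (Fin.last K))⁻¹ *
        ∫ ω in draw 0 ⁻¹' {Fin.last K}, urnCount R c₀ draw (n + 1) ω m ∂μ with hδ
  have hmeas : ∀ n a, MeasurableSet[h.filtration (n + 1)] (draw 0 ⁻¹' {a}) := fun n a =>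
    h.filtration.mono (Nat.succ_le_succ n.zero_le) _
      (h.measurable_draw 0 (measurableSet_singleton a))
  have hstep : ∀ n m, δ (n + 1) m = δ n m + ((n : ℝ) + 1 + 1)⁻¹ * ∑ l, R l m * δ n l := by
    intro n m
    have h1 := setIntegral_urnCount_succ hR hR_row hc hc_sum h (hmeas n k) m
    have h2 := setIntegral_urnCount_succ hR hR_row hc hc_sum h (hmeas n (Fin.last K)) m
    have e : ∑ l, R l m * δ n l =
        (c₀ k)⁻¹ * (∑ l, R l m * ∫ ω in draw 0 ⁻¹' {k}, urnCount R c₀ draw (n + 1) ω l ∂μ) -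
        (c₀ (Fin.last K))⁻¹ * (∑ l, R l m *
          ∫ ω in draw 0 ⁻¹' {Fin.last K}, urnCount R c₀ draw (n + 1) ω l ∂μ) := by
      rw [Finset.mul_sum, Finset.mul_sum, ← Finset.sum_sub_distrib]
      exact Finset.sum_congr rfl fun l _ => by simp only [hδ]; ring
    rw [e]
    simp only [hδ, h1, h2, smul_eq_mul]
    push_cast
    ring
  have hinit : ∀ m, δ 0 m = R k m - R (Fin.last K) m := by
    have h1 : ∀ a m, ∫ ω in draw 0 ⁻¹' {a}, urnCount R c₀ draw (0 + 1) ω m ∂μ =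
        c₀ a * (c₀ m + R a m) := fun a m => by
      rw [setIntegral_congr_fun (g := fun _ => c₀ m + R a m)
        (h.measurable 0 (measurableSet_singleton a)) fun ω hω => by
          rw [urnCount_succ, show draw 0 ω = a from hω]; rfl]
      rw [setIntegral_const, measureReal_first_draw h, smul_eq_mul]
    intro m
    have h2 := (hc k).ne'
    have h3 := (hc (Fin.last K)).ne'
    simp only [hδ, h1]
    field_simp
    ring
  have hlt : k < Fin.last K := lt_of_le_of_ne (Fin.le_last k) hk
  -- Both rows compared vanish before `k`, and triangularity preserves this, so at `k` only the
  -- homogeneous scalar recursion remains.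
  have hzero : ∀ n, ∀ m < k, δ n m = 0 := by
    intro n
    induction n with
    | zero =>
      intro m hm
      rw [hinit, hR_tri _ _ hm, hR_tri _ _ (hm.trans hlt), sub_zero]
    | succ n ih =>
      intro m hm
      rw [hstep, ih m hm, Finset.sum_eq_zero, mul_zero, add_zero]
      intro l _
      by_cases hl : l < k
      · rw [ih l hl, mul_zero]
      · rw [hR_tri _ _ (hm.trans_le (not_lt.1 hl)), zero_mul]
  have hp := riseProd_pos (hR k k)
  change δ n k = _
  induction n with
  | zero => rw [hinit, hR_tri _ _ hlt, zero_add, div_self (hp 1).ne']; ring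
  | succ n ih =>
    rw [hstep, Finset.sum_eq_single k, ih, riseProd_succ _ (n + 1)]
    · push_cast
      ring
    · intro l _ hl
      rcases lt_or_gt_of_ne hl with hl | hl
      · rw [hzero n l hl, mul_zero]
      · rw [hR_tri _ _ hl, zero_mul]
    · simp

include hR hR_row hR_tri hc hc_sum h in
/-- The `L²` limit of a scaled colour of positive diagonal entry is not constant. -/
lemma nondegenerate_limit {k : Fin (K + 1)} (hk : k ≠ Fin.last K) (hpos : 0 < R k k)
    {L : Ω → ℝ} (hL : MemLp L 2 μ)
    (hlim : Tendsto (fun n => eLpNorm (fun ω =>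
      urnCount R c₀ draw n ω k / riseProd (R k k) n - L ω) 2 μ) atTop (𝓝 0)) :
    Nondegenerate μ L := by
  rintro ⟨c, hLc⟩
  have hX := fun n => memLp_urnCount hR hR_row hc hc_sum h n k
  have hmem : ∀ n, MemLp (fun ω => urnCount R c₀ draw n ω k / riseProd (R k k) n) 2 μ := fun n => by
    simpa only [div_eq_mul_inv] using (hX n).mul_const _
  have hL1 : Tendsto (fun n => eLpNorm ((fun ω =>
      urnCount R c₀ draw n ω k / riseProd (R k k) n) - L) 1 μ) atTop (𝓝 0) :=
    tendsto_of_tendsto_of_tendsto_of_le_of_le tendsto_const_nhds hlim (fun _ => zero_le) fun n =>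
      eLpNorm_le_eLpNorm_of_exponent_le (by norm_num) ((hmem n).sub hL).1
  have hset : ∀ a, Tendsto (fun n => (c₀ a)⁻¹ * ∫ ω in draw 0 ⁻¹' {a},
      urnCount R c₀ draw n ω k / riseProd (R k k) n ∂μ) atTop (𝓝 c) := fun a => by
    have h1 := (tendsto_setIntegral_of_L1' L hL.1
      (Eventually.of_forall fun n => (hmem n).integrable (by norm_num)) hL1
      (draw 0 ⁻¹' {a})).const_mul (c₀ a)⁻¹
    have h2 : ∫ ω in draw 0 ⁻¹' {a}, L ω ∂μ = c₀ a * c := by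
      rw [integral_congr_ae (g := fun _ => c) (ae_restrict_of_ae hLc), setIntegral_const,
        measureReal_first_draw h, smul_eq_mul]
    rwa [h2, inv_mul_cancel_left₀ (hc a).ne'] at h1
  have hdiff := ((hset k).sub (hset (Fin.last K))).comp (tendsto_add_atTop_nat 1)
  rw [sub_self] at hdiff
  have hp := riseProd_pos hpos.le
  -- A constant limit would make both scaled conditional means tend to `c`, yet their difference is
  -- identically `R k k / riseProd (R k k) 1 > 0`.
  refine absurd (tendsto_nhds_unique hdiff (tendsto_const_nhds (x := R k k / riseProd (R k k) 1)
    |>.congr fun n => ?_)) (div_pos hpos (hp 1)).ne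
  have h1 := integral_urnCount_first_draw_sub hR hR_row hR_tri hc hc_sum h hk n
  have h2 := (hp (n + 1)).ne'
  simp only [Function.comp_apply, integral_div]
  rw [← mul_div_assoc, ← mul_div_assoc, ← sub_div, h1]
  field_simp

end Nondegeneracy

/-! ### Transfer to other scalings and to vectors -/

section Scaling

variable {Ω : Type*} [MeasurableSpace Ω] {μ : Measure Ω}

lemma tendsto_eLpNorm_mul {f : ℕ → Ω → ℝ} {g : Ω → ℝ} {q : ℕ → ℝ} {a : ℝ}
    (hf : ∀ n, MemLp (f n) 2 μ) (hg : MemLp g 2 μ) (hq : Tendsto q atTop (𝓝 a))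
    (h : Tendsto (fun n => eLpNorm (fun ω => f n ω - g ω) 2 μ) atTop (𝓝 0)) :
    Tendsto (fun n => eLpNorm (fun ω => q n * f n ω - a * g ω) 2 μ) atTop (𝓝 0) := by
  have h1 : Tendsto (fun n => (hf n).toLp) atTop (𝓝 hg.toLp) :=
    (Lp.tendsto_Lp_iff_tendsto_eLpNorm'' _ hf _ hg).2 h
  exact (Lp.tendsto_Lp_iff_tendsto_eLpNorm'' _ (fun n => (hf n).const_smul (q n)) _
    (hg.const_smul a)).1 (hq.smul h1)

/-- The sup norm of a finite vector is at most the sum of the absolute values of its coordinates. -/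
lemma tendsto_eLpNorm_pi {ι : Type*} [Fintype ι] {f : ℕ → Ω → ι → ℝ}
    (hf : ∀ n k, AEStronglyMeasurable (fun ω => f n ω k) μ)
    (h : ∀ k, Tendsto (fun n => eLpNorm (fun ω => f n ω k) 2 μ) atTop (𝓝 0)) :
    Tendsto (fun n => eLpNorm (f n) 2 μ) atTop (𝓝 0) := by
  have h1 : Tendsto (fun n => ∑ k, eLpNorm (fun ω => f n ω k) 2 μ) atTop (𝓝 0) := by
    simpa using tendsto_finsetSum Finset.univ fun k _ => h k
  refine tendsto_of_tendsto_of_tendsto_of_le_of_le tendsto_const_nhds h1 (fun _ => zero_le)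
    fun n => ?_
  have h2 : eLpNorm (f n) 2 μ ≤ eLpNorm (∑ k, fun ω => ‖f n ω k‖) 2 μ := by
    refine eLpNorm_mono_real fun ω => ?_
    rw [Finset.sum_apply]
    exact (pi_norm_le_iff_of_nonneg (Finset.sum_nonneg fun k _ => norm_nonneg _)).2 fun k =>
      Finset.single_le_sum (f := fun k => ‖f n ω k‖) (fun k _ => norm_nonneg _) (Finset.mem_univ k)
  refine h2.trans ((eLpNorm_sum_le (fun k _ => (hf n k).norm) (by norm_num)).trans (le_of_eq ?_))
  exact Finset.sum_congr rfl fun k _ => eLpNorm_norm _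

lemma Nondegenerate.const_mul {L : Ω → ℝ} (h : Nondegenerate μ L) {a : ℝ} (ha : a ≠ 0) :
    Nondegenerate μ fun ω => a * L ω := by
  rintro ⟨c, hc⟩
  refine h ⟨a⁻¹ * c, ?_⟩
  filter_upwards [hc] with ω hω
  rw [← hω, inv_mul_cancel_left₀ ha]

end Scaling

/-! ### The explicit limits of the first and last blocks -/

section Boundary

variable {K J : ℕ} {R : Matrix (Fin (K + 1)) (Fin (K + 1)) ℝ} {i : Fin (J + 1) → Fin (K + 1)}
  {c₀ : Fin (K + 1) → ℝ} {Ω : Type*} {draw : ℕ → Ω → Fin (K + 1)}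

lemma riseProd_one (n : ℕ) : riseProd 1 n = n + 1 := by
  induction n with
  | zero => simp [riseProd]
  | succ n ih =>
    rw [riseProd_succ, ih]
    push_cast
    field_simp

/-- The last colour takes up almost the whole urn. -/
lemma IsRunningMaxima.limit_last_eq_one (hi : IsRunningMaxima R i) (hR : ∀ a b, 0 ≤ R a b)
    (hR_row : ∀ a, ∑ b, R a b = 1) (hR_tri : ∀ a b, b < a → R a b = 0)
    (h_incr : InIncreasingOrder R i) (h_uniq : UniqueArrangement R i) (hc_sum : ∑ k, c₀ k = 1)
    {ω : Ω} {ℓ : Fin (J + 1) → ℝ}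
    (hl : ∀ k, Tendsto (fun n => urnCount R c₀ draw n ω k / blockScale R i (hi.block k) n)
      atTop (𝓝 (eigenRow R (i (hi.block k)) k * ℓ (hi.block k)))) :
    ℓ (Fin.last J) = 1 := by
  have hlast := hi.apply_last hR hR_row hR_tri
  have hlead : leadEntry R i (Fin.last J) = 1 := by
    rw [leadEntry, hlast, last_entry_eq_one hR_row hR_tri]
  -- All other leading entries are below `1`, so the last scale is exactly `n + 1`, the total
  -- content of the urn.
  have hmult : multIndex R i (Fin.last J) = 0 := hi.multIndex_eq_zero fun j hj => by
    rw [hlead]; exact hi.leadEntry_lt_one hR hR_row h_incr h_uniq hj.ne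
  have hB : ∀ n : ℕ, blockScale R i (Fin.last J) n = n + 1 := fun n => by
    rw [blockScale, hlead, hmult, scale, riseProd_one, pow_zero, mul_one]
  have hbl : hi.block (Fin.last K) = Fin.last J := by rw [← hlast, hi.block_lead]
  have h1 : ∀ k, Tendsto (fun n => urnCount R c₀ draw n ω k / blockScale R i (Fin.last J) n)
      atTop (𝓝 (if k = Fin.last K then ℓ (Fin.last J) else 0)) := fun k => by
    split_ifs with hk
    · have h2 := hl k
      have h3 : eigenRow R (Fin.last K) (Fin.last K) = 1 := eigenRow_self _
      rwa [hk, hbl, hlast, h3, one_mul, ← hk] at h2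
    · have hlt : hi.block k < Fin.last J := by
        refine lt_of_le_of_ne (Fin.le_last _) fun he => hk ?_
        have := hi.lead_block_le k
        rw [he, hlast] at this
        exact le_antisymm (Fin.le_last _) this
      have h2 := (hl k).mul (hi.tendsto_blockScale_ratio hR hlt)
      rw [mul_zero] at h2
      refine h2.congr fun n => ?_
      have := (blockScale_pos (i := i) hR (hi.block k) n).ne'
      field_simp
  have h2 := tendsto_finsetSum Finset.univ fun k _ => h1 k
  rw [Finset.sum_ite_eq' Finset.univ (Fin.last K) fun _ => ℓ (Fin.last J),
    if_pos (Finset.mem_univ _)] at h2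
  refine tendsto_nhds_unique h2 (tendsto_const_nhds.congr fun n => ?_)
  rw [← Finset.sum_div, sum_urnCount hR_row hc_sum, hB, div_self (by positivity)]

/-- A first colour that is never added keeps its initial number of balls. -/
lemma IsRunningMaxima.limit_zero_eq (hi : IsRunningMaxima R i)
    (hR_tri : ∀ a b, b < a → R a b = 0) (h0 : R 0 0 = 0)
    {ω : Ω} {ℓ : Fin (J + 1) → ℝ}
    (hl : ∀ k, Tendsto (fun n => urnCount R c₀ draw n ω k / blockScale R i (hi.block k) n)
      atTop (𝓝 (eigenRow R (i (hi.block k)) k * ℓ (hi.block k)))) :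
    ℓ 0 = c₀ 0 := by
  have h1 := hl (i 0)
  rw [hi.block_lead, eigenRow_self, one_mul] at h1
  refine tendsto_nhds_unique h1 (tendsto_const_nhds.congr fun n => ?_)
  have hcol : ∀ a, R a 0 = 0 := fun a => by
    rcases (Fin.zero_le a).eq_or_lt with ha | ha
    · rw [← ha, h0]
    · exact hR_tri _ _ ha
  have h2 : urnCount R c₀ draw n ω 0 = c₀ 0 := by
    induction n with
    | zero => rfl
    | succ n ih => rw [urnCount_succ, ih, hcol, add_zero]
  rw [hi.apply_zero, h2, blockScale, hi.multIndex_zero, leadEntry, hi.apply_zero, h0]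
  simp [scale, riseProd]

end Boundary

end TriangularUrn

/-! ### Assembly of the theorem -/

theorem theorem3p1 {K J : ℕ} (R : Matrix (Fin (K + 1)) (Fin (K + 1)) ℝ)
    (hR_nonneg : ∀ a b, 0 ≤ R a b) (hR_row : ∀ a, ∑ b, R a b = 1)
    (hR_tri : ∀ a b, b < a → R a b = 0)
    (i : Fin (J + 1) → Fin (K + 1)) (hi : TriangularUrn.IsRunningMaxima R i)
    (h_incr : TriangularUrn.InIncreasingOrder R i)
    (h_uniq : TriangularUrn.UniqueArrangement R i)
    (c₀ : Fin (K + 1) → ℝ) (hc_pos : ∀ k, 0 < c₀ k) (hc_sum : ∑ k, c₀ k = 1)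
    {Ω : Type*} [MeasurableSpace Ω] (μ : Measure Ω) [IsProbabilityMeasure μ]
    (draw : ℕ → Ω → Fin (K + 1)) (h_urn : TriangularUrn.IsUrnProcess μ R c₀ draw) :
    ∃ π : (j : Fin (J + 1)) → TriangularUrn.Block i j → ℝ,
      -- `π j` is the unique normalized left eigenvector of the `j`-th block
      (∀ j p, TriangularUrn.IsNormalizedLeftEigenvector R i j p ↔ p = π j) ∧
      ∃ V : Fin (J + 1) → Ω → ℝ,
        (∀ j, MemLp (V j) 2 μ) ∧
        -- almost sure convergence, and convergence in `L²`, of the scaled block counts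
        (∀ j, ∀ᵐ ω ∂μ, Tendsto (fun N : ℕ => TriangularUrn.scaledBlock R i c₀ draw j N ω)
          atTop (𝓝 (V j ω • π j))) ∧
        (∀ j, Tendsto (fun N : ℕ =>
          eLpNorm (fun ω => TriangularUrn.scaledBlock R i c₀ draw j N ω - V j ω • π j) 2 μ)
          atTop (𝓝 0)) ∧
        (∀ᵐ ω ∂μ, V (Fin.last J) ω = 1) ∧
        (R 0 0 = 0 → ∀ᵐ ω ∂μ, V 0 ω = c₀ 0) ∧
        (0 < R 0 0 → 0 < J → TriangularUrn.Nondegenerate μ (V 0)) ∧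
        (∀ j : Fin (J + 1), j ≠ 0 → j ≠ Fin.last J → TriangularUrn.multIndex R i j = 0 →
          TriangularUrn.Nondegenerate μ (V j)) ∧
        (∀ j : Fin J, 0 < TriangularUrn.multIndex R i j.succ →
          ∀ᵐ ω ∂μ, V j.succ ω = 1 / (TriangularUrn.multIndex R i j.succ : ℝ) *
            (π j.castSucc ⬝ᵥ TriangularUrn.nextLeadColumn R i j) * V j.castSucc ω) := by
  classical
  obtain ⟨L, hL, has, hL2, hrel⟩ :=
    TriangularUrn.exists_urnCount_limits hR_nonneg hR_row hR_tri hi hc_pos hc_sum h_urn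
  have hΓ : ∀ j, Real.Gamma (1 + TriangularUrn.leadEntry R i j) ≠ 0 := fun j =>
    (Real.Gamma_pos_of_pos (by
      linarith [TriangularUrn.leadEntry_nonneg (i := i) hR_nonneg j])).ne'
  have hq := fun j => TriangularUrn.tendsto_scale_div
    (TriangularUrn.leadEntry_nonneg (i := i) hR_nonneg j) (TriangularUrn.multIndex R i j)
  have hblk : ∀ j (k : TriangularUrn.Block i j), hi.block k.1 = j := fun j k =>
    hi.block_eq_iff.2 k.2
  -- This holds even where `N ^ λ * log N ^ ν` is zero, since both sides then vanish; only the
  -- positivity of `blockScale` is used.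
  have hscaled : ∀ j N ω (k : TriangularUrn.Block i j),
      TriangularUrn.scaledBlock R i c₀ draw j N ω k =
        TriangularUrn.blockScale R i j N / ((N : ℝ) ^ TriangularUrn.leadEntry R i j *
          Real.log N ^ TriangularUrn.multIndex R i j) *
        (TriangularUrn.urnCount R c₀ draw N ω k.1 / TriangularUrn.blockScale R i j N) := by
    intro j N ω k
    rw [TriangularUrn.scaledBlock, mul_comm (TriangularUrn.blockScale R i j N / _),
      div_mul_div_cancel₀ (TriangularUrn.blockScale_pos (i := i) hR_nonneg j N).ne']
  have hnondeg : ∀ j, j ≠ Fin.last J → TriangularUrn.multIndex R i j = 0 →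
      0 < TriangularUrn.leadEntry R i j → TriangularUrn.Nondegenerate μ
        fun ω => (Real.Gamma (1 + TriangularUrn.leadEntry R i j))⁻¹ * L j ω := by
    intro j hj hν hpos
    refine (TriangularUrn.nondegenerate_limit hR_nonneg hR_row hR_tri hc_pos hc_sum h_urn
      (k := i j) (fun h => hj (hi.strictMono.injective ?_)) hpos (hL j) ?_).const_mul
      (inv_ne_zero (hΓ j))
    · rw [h, hi.apply_last hR_nonneg hR_row hR_tri]
    · have h1 := hL2 (i j)
      simpa only [hi.block_lead, TriangularUrn.eigenRow_self, one_mul, TriangularUrn.blockScale,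
        hν, TriangularUrn.scale, pow_zero, mul_one, TriangularUrn.leadEntry] using h1
  refine ⟨fun j k => TriangularUrn.eigenRow R (i j) k.1,
    fun j p => TriangularUrn.isNormalizedLeftEigenvector_iff hR_tri hi j p,
    -- `blockScale` is asymptotic to `N ^ λ * log N ^ ν / Γ (1 + λ)`, whence the factor in `V`.
    fun j ω => (Real.Gamma (1 + TriangularUrn.leadEntry R i j))⁻¹ * L j ω,
    fun j => (hL j).const_mul _, fun j => ?_, fun j => ?_, ?_, fun h0 => ?_, fun h0 hJ => ?_,
    fun j hj0 hjl hν => ?_, fun j hν => ?_⟩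
  · filter_upwards [has] with ω hω
    refine tendsto_pi_nhds.2 fun k => ?_
    have h1 := hω k.1
    rw [hblk j k] at h1
    refine (((hq j).mul h1).congr fun N => (hscaled j N ω k).symm).trans_eq ?_
    simp only [Pi.smul_apply, smul_eq_mul]
    congr 1
    ring
  · have hmem : ∀ N (k : TriangularUrn.Block i j), MemLp (fun ω =>
        TriangularUrn.urnCount R c₀ draw N ω k.1 / TriangularUrn.blockScale R i j N) 2 μ :=
      fun N k => by
        simpa only [div_eq_mul_inv] using
          (TriangularUrn.memLp_urnCount hR_nonneg hR_row hc_pos hc_sum h_urn N k.1).mul_const _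
    have hlim : ∀ k : TriangularUrn.Block i j,
        MemLp (fun ω => TriangularUrn.eigenRow R (i j) k.1 * L j ω) 2 μ :=
      fun k => (hL j).const_mul _
    have hcoord : ∀ N ω (k : TriangularUrn.Block i j),
        (TriangularUrn.scaledBlock R i c₀ draw j N ω -
        ((Real.Gamma (1 + TriangularUrn.leadEntry R i j))⁻¹ * L j ω) •
          fun k : TriangularUrn.Block i j => TriangularUrn.eigenRow R (i j) k.1) k =
        TriangularUrn.blockScale R i j N / ((N : ℝ) ^ TriangularUrn.leadEntry R i j *
          Real.log N ^ TriangularUrn.multIndex R i j) *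
        (TriangularUrn.urnCount R c₀ draw N ω k.1 / TriangularUrn.blockScale R i j N) -
        (Real.Gamma (1 + TriangularUrn.leadEntry R i j))⁻¹ *
          (TriangularUrn.eigenRow R (i j) k.1 * L j ω) := fun N ω k => by
      rw [Pi.sub_apply, hscaled, Pi.smul_apply, smul_eq_mul]
      ring
    refine TriangularUrn.tendsto_eLpNorm_pi (fun N k => ?_) fun k => ?_
    · simp only [hcoord]
      exact (((hmem N k).const_mul _).sub ((hlim k).const_mul _)).1
    · simp only [hcoord]
      refine TriangularUrn.tendsto_eLpNorm_mul (fun N => hmem N k) (hlim k) (hq j) ?_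
      have h1 := hL2 k.1
      rwa [hblk j k] at h1
  · filter_upwards [has] with ω hω
    have h1 := hi.limit_last_eq_one hR_nonneg hR_row hR_tri h_incr h_uniq hc_sum
      (ℓ := fun j => L j ω) hω
    have h2 : TriangularUrn.leadEntry R i (Fin.last J) = 1 := by
      rw [TriangularUrn.leadEntry, hi.apply_last hR_nonneg hR_row hR_tri,
        TriangularUrn.last_entry_eq_one hR_row hR_tri]
    rw [h1, h2, one_add_one_eq_two, Real.Gamma_two, inv_one, one_mul]
  · filter_upwards [has] with ω hω
    have h1 := hi.limit_zero_eq hR_tri h0 (ℓ := fun j => L j ω) hω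
    rw [h1, TriangularUrn.leadEntry, hi.apply_zero, h0, add_zero, Real.Gamma_one, inv_one, one_mul]
  · have hne : (0 : Fin (J + 1)) ≠ Fin.last J := fun h => by
      have := congrArg Fin.val h
      simp at this
      omega
    exact hnondeg 0 hne hi.multIndex_zero (by rwa [TriangularUrn.leadEntry, hi.apply_zero])
  · obtain ⟨j, rfl⟩ := Fin.exists_succ_eq.2 hj0
    refine hnondeg _ hjl hν 
      ((TriangularUrn.leadEntry_nonneg (i := i) hR_nonneg j.castSucc).trans_lt ?_)
    -- With `ν_j = 0` the leading entry strictly exceeds the previous one, which is nonnegative, and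
    -- is therefore positive.
    refine lt_of_le_of_ne (hi.leadEntry_mono Fin.castSucc_lt_succ.le) fun h => ?_
    rw [hi.multIndex_succ_of_eq h] at hν
    omega
  · filter_upwards [hrel j hν] with ω hω
    have h1 : (fun k : TriangularUrn.Block i j.castSucc =>
        TriangularUrn.eigenRow R (i j.castSucc) k.1) ⬝ᵥ TriangularUrn.nextLeadColumn R i j =
        ∑ m, if hi.block m = j.castSucc then
          TriangularUrn.eigenRow R (i j.castSucc) m * R m (i j.succ) else 0 :=
      TriangularUrn.sum_block_eq hi j.castSucc fun m =>
        TriangularUrn.eigenRow R (i j.castSucc) m * R m (i j.succ)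
    -- Resonant blocks share the same `λ`, so the Gamma factors on the two sides coincide.
    rw [h1, hω, hi.leadEntry_eq_of_multIndex_pos hν]
    ring
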